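/- Let $\Xi\subset\mathbb{R}^r$ and let $f:\mathbb{R}^n\times\Xi\to\mathbb{R}$, $h:\mathbb{R}^n\times\Xi\to\mathbb{R}^p$, $g:\mathbb{R}^n\times\Xi\to\mathbb{R}^m$ be twice continuously differentiable in $(x,\xi)$. Consider the parametrized problem of minimizing $f(x,\xi)$ over $x\in\mathbb{R}^n$ subject to $h(x,\xi)=0$, $g(x,\xi)\le 0$, with feasible set $\mathcal{X}(\xi)$ and Lagrangian $L(x,\lambda,\mu,\xi)=f(x,\xi)+\lambda^\top h(x,\xi)+\mu^\top g(x,\xi)$. All norms are Euclidean norms and the induced operator norms. A triple $(x,\lambda,\mu)\in\mathcal{X}(\xi)\times\mathbb{R}^p\times\mathbb{R}^m_{\ge0}$ is a regular minimizer for $\xi$ if: (LICQ) the gradients $\nabla_x h_j(x,\xi)$, $1\le j\le p$, and $\nabla_x g_i(x,\xi)$, $i\in\mathbf{I}:=\{i: g_i(x,\xi)=0\}$, are linearly independent; (KKT) $\nabla_xL(x,\lambda,\mu,\xi)=0$ and $\mu_i=0$ whenever $g_i(x,\xi)<0$; (SSOSC) $y^\top\nabla^2_{xx}L(x,\lambda,\mu,\xi)\,y>0$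 for every $y\ne0$ with $\nabla_xh(x,\xi)y=0$ and $\nabla_xg_i(x,\xi)y=0$ for all $i$ with $\mu_i>0$. Let $\bar\xi$ be an interior point of $\Xi$, let $(\bar x,\bar\lambda,\bar\mu)$ be a regular minimizer for $\bar\xi$ (strict complementarity is not assumed), and assume that $A:=\nabla^2_{xx}L(\bar x,\bar\lambda,\bar\mu,\bar\xi)$ is positive definite. Let $\mathbf{I}:=\{i: g_i(\bar x,\bar\xi)=0\}$ be the set of all active inequality constraints, weakly active ones ($\bar\mu_i=0$) included, and put $$B:=\begin{bmatrix}\nabla_xh(\bar x,\bar\xi)\\ \nabla_xg_{\mathbf{I}}(\bar x,\bar\xi)\end{bmatrix},\qquad G^\star:=\begin{bmatrix}\nabla_\xi h(\bar x,\bar\xi)\\ \nabla_\xi g_{\mathbf{I}}(\bar x,\bar\xi)\end{bmatrix},\qquad L^\star:=\nabla_\xi\big(\nabla_xL\big)^{\top}(\bar x,\bar\lambda,\bar\mu,\bar\xi)\in\mathbb{R}^{n\times r}.$$ Write $\lambda^{\max}_A,\lambda^{\min}_A$ for the extreme eigenvalues of $A$ and $\sigma^{\min}_{B^\top}$ for the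 smallest singular value of $B^\top$, and let $$\ell_{x^\star}:=\sqrt{\frac{\lambda^{\max}_A}{\lambda^{\min}_A}}\left(\frac{\|L^\star\|}{\lambda^{\min}_A}+\frac{\|G^\star\|}{\sigma^{\min}_{B^\top}}\right),\qquad \ell_{(\lambda^\star,\mu^\star)}:=\frac{(\lambda^{\max}_A)^{3/2}}{\sigma^{\min}_{B^\top}(\lambda^{\min}_A)^{1/2}}\left(\frac{\|L^\star\|}{\lambda^{\min}_A}+\frac{\|G^\star\|}{\sigma^{\min}_{B^\top}}\right);$$ if $p=0$ and $\mathbf{I}=\emptyset$, the term $\|G^\star\|/\sigma^{\min}_{B^\top}$ is read as $0$ and $\ell_{(\lambda^\star,\mu^\star)}:=0$. Then there exist a neighborhood $\mathcal{N}\subset\Xi$ of $\bar\xi$ and continuous maps $x^\star:\mathcal{N}\to\mathbb{R}^n$, $\lambda^\star:\mathcal{N}\to\mathbb{R}^p$, $\mu^\star:\mathcal{N}\to\mathbb{R}^m_{\ge0}$ such that $(x^\star,\lambda^\star,\mu^\star)(\bar\xi)=(\bar x,\bar\lambda,\bar\mu)$ and, for every $\xi\in\mathcal{N}$, $(x^\star(\xi),\lambda^\star(\xi),\mu^\star(\xi))$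 is a regular minimizer for $\xi$ and $x^\star(\xi)$ is a local minimizer of $f(\cdot,\xi)$ on $\mathcal{X}(\xi)$. Moreover, for all such $\mathcal{N}$ and $x^\star,\lambda^\star,\mu^\star$, the maps $x^\star$ and $(\lambda^\star,\mu^\star):\mathcal{N}\to\mathbb{R}^{p+m}$ are locally Lipschitz at $\bar\xi$ with Lipschitz constants bounded by $\ell_{x^\star}$ and $\ell_{(\lambda^\star,\mu^\star)}$, respectively: for every $\ell>\ell_{x^\star}$ there is a neighborhood $U\subset\mathcal{N}$ of $\bar\xi$ with $\|x^\star(\xi)-x^\star(\xi')\|\le\ell\|\xi-\xi'\|$ for all $\xi,\xi'\in U$, and for every $\ell>\ell_{(\lambda^\star,\mu^\star)}$ there is a neighborhood $U\subset\mathcal{N}$ of $\bar\xi$ with $\|(\lambda^\star,\mu^\star)(\xi)-(\lambda^\star,\mu^\star)(\xi')\|\le\ell\|\xi-\xi'\|$ for all $\xi,\xi'\in U$. -/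

import Mathlib

open Set Filter Topology

noncomputable section

/-- The data of a parametrized nonlinear program
`minimize f(x, ξ)` over `x ∈ ℝⁿ` subject to `h(x, ξ) = 0` and `g(x, ξ) ≤ 0`,
with `p` equality constraints, `m` inequality constraints and a parameter `ξ` in `ℝʳ`. -/
structure ParamNLP (n p m r : ℕ) where
  /-- objective -/
  f : EuclideanSpace ℝ (Fin n) → EuclideanSpace ℝ (Fin r) → ℝ
  /-- equality constraints -/
  h : EuclideanSpace ℝ (Fin n) → EuclideanSpace ℝ (Fin r) → EuclideanSpace ℝ (Fin p)
  /-- inequality constraints -/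
  g : EuclideanSpace ℝ (Fin n) → EuclideanSpace ℝ (Fin r) → EuclideanSpace ℝ (Fin m)

namespace ParamNLP

variable {n p m r : ℕ} (P : ParamNLP n p m r)

/-- `f`, `h`, `g` are twice continuously differentiable in `(x, ξ)` on `ℝⁿ × Ξ`. -/
structure IsC2On (Ξ : Set (EuclideanSpace ℝ (Fin r))) : Prop where
  f : ContDiffOn ℝ 2
    (fun z : EuclideanSpace ℝ (Fin n) × EuclideanSpace ℝ (Fin r) => P.f z.1 z.2) (univ ×ˢ Ξ)
  h : ContDiffOn ℝ 2
    (fun z : EuclideanSpace ℝ (Fin n) × EuclideanSpace ℝ (Fin r) => P.h z.1 z.2) (univ ×ˢ Ξ)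
  g : ContDiffOn ℝ 2
    (fun z : EuclideanSpace ℝ (Fin n) × EuclideanSpace ℝ (Fin r) => P.g z.1 z.2) (univ ×ˢ Ξ)

/-- The feasible set `X(ξ)`. -/
def feasible (ξ : EuclideanSpace ℝ (Fin r)) : Set (EuclideanSpace ℝ (Fin n)) :=
  {x | P.h x ξ = 0 ∧ ∀ i, P.g x ξ i ≤ 0}

/-- The index set of the inequality constraints that are active at `x` for the parameter `ξ`. -/
def active (x : EuclideanSpace ℝ (Fin n)) (ξ : EuclideanSpace ℝ (Fin r)) : Finset (Fin m) :=
  (Set.toFinite {i : Fin m | P.g x ξ i = 0}).toFinset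

/-- The Lagrangian `L(x, l, u, ξ) = f(x, ξ) + lᵀ h(x, ξ) + uᵀ g(x, ξ)`. -/
def lagrangian (x : EuclideanSpace ℝ (Fin n)) (l : EuclideanSpace ℝ (Fin p))
    (u : EuclideanSpace ℝ (Fin m)) (ξ : EuclideanSpace ℝ (Fin r)) : ℝ :=
  P.f x ξ + ∑ j, l j * P.h x ξ j + ∑ i, u i * P.g x ξ i

/-- The gradient (a column vector) of the Lagrangian with respect to `x`. -/
def gradL (x : EuclideanSpace ℝ (Fin n)) (l : EuclideanSpace ℝ (Fin p))
    (u : EuclideanSpace ℝ (Fin m)) (ξ : EuclideanSpace ℝ (Fin r)) : EuclideanSpace ℝ (Fin n) :=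
  gradient (fun y => P.lagrangian y l u ξ) x

/-- `A = ∇²ₓₓ L`, the Hessian of the Lagrangian with respect to `x`, as a linear map. -/
def hessL (x : EuclideanSpace ℝ (Fin n)) (l : EuclideanSpace ℝ (Fin p))
    (u : EuclideanSpace ℝ (Fin m)) (ξ : EuclideanSpace ℝ (Fin r)) :
    EuclideanSpace ℝ (Fin n) →L[ℝ] EuclideanSpace ℝ (Fin n) :=
  fderiv ℝ (fun y => P.gradL y l u ξ) x

/-- `L⋆ = ∇²_{ξx} L`, the Jacobian with respect to `ξ` of the `x`-gradient of the Lagrangian. -/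
def mixedL (x : EuclideanSpace ℝ (Fin n)) (l : EuclideanSpace ℝ (Fin p))
    (u : EuclideanSpace ℝ (Fin m)) (ξ : EuclideanSpace ℝ (Fin r)) :
    EuclideanSpace ℝ (Fin r) →L[ℝ] EuclideanSpace ℝ (Fin n) :=
  fderiv ℝ (fun ζ => P.gradL x l u ζ) ξ

/-- The stacked constraint vector `(h, g_S)` for an index set `S` of inequality constraints. -/
def constr (S : Finset (Fin m)) (x : EuclideanSpace ℝ (Fin n)) (ξ : EuclideanSpace ℝ (Fin r)) :
    EuclideanSpace ℝ (Fin p ⊕ S) :=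
  WithLp.toLp 2 (Sum.elim (fun j => P.h x ξ j) (fun i => P.g x ξ i))

/-- `B`: the `x`-Jacobian of the equality constraints stacked with all active inequality
constraints (weakly active ones included). -/
def jacX (x : EuclideanSpace ℝ (Fin n)) (ξ : EuclideanSpace ℝ (Fin r)) :
    EuclideanSpace ℝ (Fin n) →L[ℝ] EuclideanSpace ℝ (Fin p ⊕ P.active x ξ) :=
  fderiv ℝ (fun y => P.constr (P.active x ξ) y ξ) x

/-- `G⋆`: the `ξ`-Jacobian of the equality constraints stacked with all active inequality
constraints (weakly active ones included). -/
def jacXi (x : EuclideanSpace ℝ (Fin n)) (ξ : EuclideanSpace ℝ (Fin r)) :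
    EuclideanSpace ℝ (Fin r) →L[ℝ] EuclideanSpace ℝ (Fin p ⊕ P.active x ξ) :=
  fderiv ℝ (fun ζ => P.constr (P.active x ξ) x ζ) ξ

/-- Linear independence constraint qualification: the `x`-gradients of the equality constraints
and of the active inequality constraints are linearly independent. -/
def LICQ (x : EuclideanSpace ℝ (Fin n)) (ξ : EuclideanSpace ℝ (Fin r)) : Prop :=
  LinearIndependent ℝ (fun k : Fin p ⊕ P.active x ξ =>
    gradient (fun y => P.constr (P.active x ξ) y ξ k) x)

/-- The Karush-Kuhn-Tucker conditions. -/
structure KKT (x : EuclideanSpace ℝ (Fin n)) (l : EuclideanSpace ℝ (Fin p))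
    (u : EuclideanSpace ℝ (Fin m)) (ξ : EuclideanSpace ℝ (Fin r)) : Prop where
  mem_feasible : x ∈ P.feasible ξ
  nonneg : ∀ i, 0 ≤ u i
  stationary : P.gradL x l u ξ = 0
  compl : ∀ i, P.g x ξ i < 0 → u i = 0

/-- Strong second-order sufficiency condition. -/
def SSOSC (x : EuclideanSpace ℝ (Fin n)) (l : EuclideanSpace ℝ (Fin p))
    (u : EuclideanSpace ℝ (Fin m)) (ξ : EuclideanSpace ℝ (Fin r)) : Prop :=
  ∀ y : EuclideanSpace ℝ (Fin n), y ≠ 0 →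
    fderiv ℝ (fun z => P.h z ξ) x y = 0 →
    (∀ i, 0 < u i → fderiv ℝ (fun z => P.g z ξ i) x y = 0) →
    0 < inner ℝ y (P.hessL x l u ξ y)

/-- `(x, l, u)` is a regular minimizer for the parameter `ξ`. -/
structure IsRegularMinimizer (x : EuclideanSpace ℝ (Fin n)) (l : EuclideanSpace ℝ (Fin p))
    (u : EuclideanSpace ℝ (Fin m)) (ξ : EuclideanSpace ℝ (Fin r)) : Prop where
  licq : P.LICQ x ξ
  kkt : P.KKT x l u ξ
  ssosc : P.SSOSC x l u ξ

/-- `(xs, ls, us)` are continuous primal and dual solution maps on a neighborhood `N ⊆ Ξ` of `ξ₀`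
through the point `(x₀, l₀, u₀)`. Only the values of the maps on `N` matter. -/
structure IsSolutionMap (Ξ : Set (EuclideanSpace ℝ (Fin r)))
    (x₀ : EuclideanSpace ℝ (Fin n)) (l₀ : EuclideanSpace ℝ (Fin p))
    (u₀ : EuclideanSpace ℝ (Fin m)) (ξ₀ : EuclideanSpace ℝ (Fin r))
    (N : Set (EuclideanSpace ℝ (Fin r)))
    (xs : EuclideanSpace ℝ (Fin r) → EuclideanSpace ℝ (Fin n))
    (ls : EuclideanSpace ℝ (Fin r) → EuclideanSpace ℝ (Fin p))
    (us : EuclideanSpace ℝ (Fin r) → EuclideanSpace ℝ (Fin m)) : Prop where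
  mem_nhds : N ∈ 𝓝 ξ₀
  subset : N ⊆ Ξ
  continuousOn_x : ContinuousOn xs N
  continuousOn_l : ContinuousOn ls N
  continuousOn_u : ContinuousOn us N
  base_x : xs ξ₀ = x₀
  base_l : ls ξ₀ = l₀
  base_u : us ξ₀ = u₀
  regular : ∀ ξ ∈ N, P.IsRegularMinimizer (xs ξ) (ls ξ) (us ξ) ξ
  isLocalMin : ∀ ξ ∈ N, IsLocalMinOn (fun x => P.f x ξ) (P.feasible ξ) (xs ξ)

end ParamNLP

/-- Largest (real) eigenvalue. -/
def lamMax {n : ℕ} (A : EuclideanSpace ℝ (Fin n) →L[ℝ] EuclideanSpace ℝ (Fin n)) : ℝ :=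
  sSup {t : ℝ | Module.End.HasEigenvalue A.toLinearMap t}

/-- Smallest (real) eigenvalue. -/
def lamMin {n : ℕ} (A : EuclideanSpace ℝ (Fin n) →L[ℝ] EuclideanSpace ℝ (Fin n)) : ℝ :=
  sInf {t : ℝ | Module.End.HasEigenvalue A.toLinearMap t}

/-- Smallest singular value of an `a × b` matrix: the last one of its `min a b` singular values
in descending order (Mathlib numbers them from `0`). -/
def sigmaMin {ι κ : Type*} [Fintype ι] [Fintype κ]
    (T : EuclideanSpace ℝ ι →L[ℝ] EuclideanSpace ℝ κ) : ℝ :=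
  T.toLinearMap.singularValues (min (Fintype.card ι) (Fintype.card κ) - 1)

namespace ParamNLP

variable {n p m r : ℕ} (P : ParamNLP n p m r)

/-- `‖L⋆‖ / λmin(A) + ‖G⋆‖ / σmin(Bᵀ)`. If there are no equality constraints and no active
inequality constraints, then `G⋆ = 0` and the second summand is `0`. -/
def ellBase (x : EuclideanSpace ℝ (Fin n)) (l : EuclideanSpace ℝ (Fin p))
    (u : EuclideanSpace ℝ (Fin m)) (ξ : EuclideanSpace ℝ (Fin r)) : ℝ :=
  ‖P.mixedL x l u ξ‖ / lamMin (P.hessL x l u ξ)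
    + ‖P.jacXi x ξ‖ / sigmaMin (ContinuousLinearMap.adjoint (P.jacX x ξ))

/-- The bound for the Lipschitz constant of the primal solution map. -/
def ellPrimal (x : EuclideanSpace ℝ (Fin n)) (l : EuclideanSpace ℝ (Fin p))
    (u : EuclideanSpace ℝ (Fin m)) (ξ : EuclideanSpace ℝ (Fin r)) : ℝ :=
  √(lamMax (P.hessL x l u ξ) / lamMin (P.hessL x l u ξ)) * P.ellBase x l u ξ

open Classical in
/-- The bound for the Lipschitz constant of the dual solution map. If there are no equality
constraints and no active inequality constraints, then `B` has no rows and the bound is `0`. -/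
def ellDual (x : EuclideanSpace ℝ (Fin n)) (l : EuclideanSpace ℝ (Fin p))
    (u : EuclideanSpace ℝ (Fin m)) (ξ : EuclideanSpace ℝ (Fin r)) : ℝ :=
  if IsEmpty (Fin p ⊕ P.active x ξ) then 0
  else
    lamMax (P.hessL x l u ξ) ^ (3 / 2 : ℝ)
      / (sigmaMin (ContinuousLinearMap.adjoint (P.jacX x ξ))
          * lamMin (P.hessL x l u ξ) ^ (1 / 2 : ℝ))
      * P.ellBase x l u ξ

end ParamNLP

/-- `F : S → Y` is locally Lipschitz at `a ∈ S` with constant bounded by `ℓ₀`: for every `ℓ > ℓ₀`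
there is a relative neighborhood of `a` in `S` on which `F` is `ℓ`-Lipschitz. -/
def LocallyLipschitzAtWith {X Y : Type*} [NormedAddCommGroup X] [NormedAddCommGroup Y]
    (ℓ₀ : ℝ) (F : X → Y) (S : Set X) (a : X) : Prop :=
  ∀ ℓ : ℝ, ℓ₀ < ℓ → ∃ U ∈ 𝓝[S] a, U ⊆ S ∧ ∀ y ∈ U, ∀ z ∈ U, ‖F y - F z‖ ≤ ℓ * ‖y - z‖

end

/-! Near the base point the inactive constraints stay strictly negative, so their multipliers vanish
and only the system with the index set frozen at `P.active x₀ ξ₀` matters: stationarity, equalities,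
and complementarity for the active inequalities (`ReducedKKT`). Without strict complementarity this
is not a smooth system of equations, so the implicit function theorem cannot be applied to it as a
whole. Two arguments replace it.

Rate. For two solutions, with differences Δx, Δv, Δc, complementarity forces Δv_k Δc_k ≥ 0 for every
constraint, whichever ones stay active (`ReducedKKT.mul_sub_nonneg`). By strict differentiability,
up to errors of small relative size, A Δx + Bᵀ Δv = -L⋆ Δξ and Δv_k (B Δx - γ)_k ≥ 0 with γ = -G⋆
Δξ. In `saddle_bound` the sign condition becomes a linear relation with nonnegative diagonal
coefficients. The solution then splits into a response to the stationarity perturbation and a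
response to the constraint perturbation, each bounded by an energy estimate. The sums are at most
the stated constants because λmin ≤ λmax.

Existence. Since A is positive definite, x can be eliminated from stationarity. The constraint
values, as a function of the multiplier, then have derivative -B A⁻¹ Bᵀ, which is negative definite
by LICQ. Projected dual ascent with a small step is therefore a contraction, and its fixed points
solve the reduced system (`ReducedKKT.eventually_exists`). The rate estimate makes any selection of
solutions near the base point continuous and, applied with equal parameters, fixes its value at the
base point. LICQ and coercivity of the Hessian persist nearby, and a local minimum of the Lagrangian
at a KKT point is a constrained local minimum. -/

/-! ### Energy estimates for linear saddle point systems with sign conditions -/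

section LinearEstimates

variable {E : Type*} [NormedAddCommGroup E] [InnerProductSpace ℝ E]

/-- A coercive operator is bounded below. -/
lemma norm_le_norm_apply_of_coercive {A : E →L[ℝ] E} {a : ℝ}
    (hmin : ∀ y, a * ‖y‖ ^ 2 ≤ inner ℝ y (A y)) (y : E) : a * ‖y‖ ≤ ‖A y‖ := by
  rcases eq_or_ne y 0 with rfl | hy
  · simp
  · have hy' : 0 < ‖y‖ := norm_pos_iff.2 hy
    have h1 := hmin y
    have h2 := real_inner_le_norm y (A y)
    nlinarith

variable [FiniteDimensional ℝ E] {κ : Type*} [Fintype κ]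

lemma surjective_of_coercive {A : E →L[ℝ] E} {a : ℝ} (ha : 0 < a)
    (hmin : ∀ y, a * ‖y‖ ^ 2 ≤ inner ℝ y (A y)) : Function.Surjective A := by
  have hinj : Function.Injective A.toLinearMap := by
    rw [← LinearMap.ker_eq_bot, LinearMap.ker_eq_bot']
    intro y hy
    have h1 := norm_le_norm_apply_of_coercive hmin y
    have hy' : A y = 0 := hy
    rw [hy', norm_zero] at h1
    have h2 : ‖y‖ ≤ 0 := by
      by_contra! h
      nlinarith
    exact norm_le_zero_iff.1 h2
  exact LinearMap.injective_iff_surjective.1 hinj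

variable {A : E →L[ℝ] E} {B : E →L[ℝ] EuclideanSpace ℝ κ} {a b σ : ℝ}

/-- Saddle point system with a perturbation of the stationarity equation only. -/
lemma saddle_bound_of_stationarity (hA : ∀ y z, inner ℝ (A y) z = inner ℝ y (A z))
    (ha : 0 < a) (hb : 0 < b)
    (hmin : ∀ y, a * ‖y‖ ^ 2 ≤ inner ℝ y (A y))
    (hmax : ∀ y, ‖A y‖ ^ 2 ≤ b * inner ℝ y (A y)) (hσ : 0 < σ)
    (hB : ∀ v, σ * ‖v‖ ≤ ‖ContinuousLinearMap.adjoint B v‖)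
    {x e : E} {v : EuclideanSpace ℝ κ}
    (h1 : A x + ContinuousLinearMap.adjoint B v = e) (h2 : 0 ≤ inner ℝ v (B x)) :
    ‖x‖ ≤ ‖e‖ / a ∧ ‖v‖ ≤ b / a * ‖e‖ / σ := by
  have hxB : inner ℝ x (ContinuousLinearMap.adjoint B v) = inner ℝ v (B x) := by
    rw [ContinuousLinearMap.adjoint_inner_right, real_inner_comm]
  have hx : inner ℝ x (A x) ≤ inner ℝ x e := by
    rw [← h1, inner_add_right, hxB]; linarith
  constructor
  · rw [le_div_iff₀ ha]
    rcases eq_or_ne x 0 with rfl | hx0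
    · simp
    · have hx' : 0 < ‖x‖ := norm_pos_iff.2 hx0
      have h3 := hmin x
      have h4 := real_inner_le_norm x e
      nlinarith
  -- With q = A⁻¹ Bᵀ v, pairing the equation with q makes the cross term ⟨x, A q⟩ = ⟨v, B x⟩ ≥ 0, so
  -- ⟨q, A q⟩ ≤ ⟨q, e⟩. This bounds ‖Bᵀ v‖ = ‖A q‖ by b/a ‖e‖.
  · obtain ⟨q, hq⟩ := surjective_of_coercive ha hmin (ContinuousLinearMap.adjoint B v)
    have hqe : inner ℝ q (A q) ≤ inner ℝ q e := by
      have h3 : inner ℝ q (A q) + inner ℝ x (A q) = inner ℝ q e := by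
        rw [← h1, inner_add_right, ← hA q x, hq, real_inner_comm x, add_comm]
      rw [hq, hxB] at h3
      rw [hq]; linarith
    have h3 := hB v
    rw [← hq] at h3
    have h4 := hmax q
    have h5 := real_inner_le_norm q e
    have h6 := norm_le_norm_apply_of_coercive hmin q
    have h7 : ‖A q‖ ≤ b / a * ‖e‖ := by
      rcases (norm_nonneg (A q)).eq_or_lt with h | h
      · rw [← h]; positivity
      · have h8 : ‖A q‖ ^ 2 ≤ b * (‖A q‖ / a * ‖e‖) := by
          have h9 : ‖q‖ ≤ ‖A q‖ / a := by rw [le_div_iff₀ ha]; linarith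
          calc ‖A q‖ ^ 2 ≤ b * inner ℝ q (A q) := h4
            _ ≤ b * (‖q‖ * ‖e‖) := by gcongr; linarith
            _ ≤ _ := by gcongr
        have h10 : ‖A q‖ * ‖A q‖ ≤ ‖A q‖ * (b / a * ‖e‖) := by
          calc _ = ‖A q‖ ^ 2 := by ring
            _ ≤ _ := h8
            _ = _ := by ring
        exact le_of_mul_le_mul_left h10 h
    rw [le_div_iff₀ hσ]; linarith

/-- Saddle point system with a perturbation of the constraints only. -/
lemma saddle_bound_of_constraint
    (ha : 0 < a) (hb : 0 < b)
    (hmin : ∀ y, a * ‖y‖ ^ 2 ≤ inner ℝ y (A y))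
    (hmax : ∀ y, ‖A y‖ ^ 2 ≤ b * inner ℝ y (A y)) (hσ : 0 < σ)
    (hB : ∀ v, σ * ‖v‖ ≤ ‖ContinuousLinearMap.adjoint B v‖)
    {x : E} {v γ : EuclideanSpace ℝ κ}
    (h1 : A x + ContinuousLinearMap.adjoint B v = 0) (h2 : inner ℝ v γ ≤ inner ℝ v (B x)) :
    ‖x‖ ≤ √(b / a) * (‖γ‖ / σ) ∧ ‖v‖ ≤ b * ‖γ‖ / σ ^ 2 := by
  have hxB : inner ℝ x (ContinuousLinearMap.adjoint B v) = inner ℝ v (B x) := by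
    rw [ContinuousLinearMap.adjoint_inner_right, real_inner_comm]
  have hx : inner ℝ x (A x) ≤ ‖v‖ * ‖γ‖ := by
    have h3 : inner ℝ x (A x) + inner ℝ v (B x) = 0 := by
      rw [← hxB, ← inner_add_right, h1, inner_zero_right]
    have h4 := real_inner_le_norm (-v) γ
    rw [inner_neg_left, norm_neg] at h4
    linarith
  have hAv : ‖A x‖ = ‖ContinuousLinearMap.adjoint B v‖ := by
    rw [eq_neg_of_add_eq_zero_left h1, norm_neg]
  have h3 := hB v
  rw [← hAv] at h3
  have h4 := hmax x
  -- Here A x = -Bᵀ v, so (σ‖v‖)² ≤ ‖A x‖² ≤ b ⟨x, A x⟩ ≤ b ‖v‖ ‖γ‖, and one factor ‖v‖ cancels. The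
  -- bound for x follows by inserting this one into a ‖x‖² ≤ ‖v‖ ‖γ‖.
  have hv : ‖v‖ ≤ b * ‖γ‖ / σ ^ 2 := by
    rw [le_div_iff₀ (by positivity)]
    rcases (norm_nonneg v).eq_or_lt with h | h
    · rw [← h]; simp only [zero_mul]; positivity
    · have h5 : (σ * ‖v‖) ^ 2 ≤ b * (‖v‖ * ‖γ‖) :=
        (pow_le_pow_left₀ (by positivity) h3 2).trans (h4.trans (by gcongr))
      have h6 : ‖v‖ * (‖v‖ * σ ^ 2) ≤ ‖v‖ * (b * ‖γ‖) := by nlinarith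
      exact le_of_mul_le_mul_left h6 h
  refine ⟨?_, hv⟩
  refine le_of_sq_le_sq ?_ (by positivity)
  rw [mul_pow, Real.sq_sqrt (by positivity)]
  have h5 : a * ‖x‖ ^ 2 ≤ b * ‖γ‖ / σ ^ 2 * ‖γ‖ := (hmin x).trans (hx.trans (by gcongr))
  calc ‖x‖ ^ 2 = a * ‖x‖ ^ 2 / a := by field_simp
    _ ≤ b * ‖γ‖ / σ ^ 2 * ‖γ‖ / a := by gcongr
    _ = _ := by field_simp

/-- Bounds for a linear complementarity system: the slacks `B x - γ` and the multipliers `v` have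
the same signs. -/
theorem saddle_bound (hA : ∀ y z, inner ℝ (A y) z = inner ℝ y (A z))
    (ha : 0 < a) (hb : 0 < b)
    (hmin : ∀ y, a * ‖y‖ ^ 2 ≤ inner ℝ y (A y))
    (hmax : ∀ y, ‖A y‖ ^ 2 ≤ b * inner ℝ y (A y)) (hσ : 0 < σ)
    (hB : ∀ v, σ * ‖v‖ ≤ ‖ContinuousLinearMap.adjoint B v‖)
    {x e : E} {v γ : EuclideanSpace ℝ κ}
    (h1 : A x + ContinuousLinearMap.adjoint B v = e) (h2 : ∀ k, 0 ≤ v k * (B x k - γ k)) :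
    ‖x‖ ≤ ‖e‖ / a + √(b / a) * (‖γ‖ / σ) ∧
      ‖v‖ ≤ b / a * ‖e‖ / σ + b * ‖γ‖ / σ ^ 2 := by
  classical
  -- Ratio of slack to multiplier, nonnegative by the sign condition. Freezing it turns that
  -- condition into the linear relation (B x)_k - t_k v_k = γ_k where v_k ≠ 0, and v_k = 0
  -- elsewhere; linearity is what permits superposition.
  let t : κ → ℝ := fun k => (B x k - γ k) / v k
  have ht : ∀ k, 0 ≤ t k := fun k => by
    have : t k = v k * (B x k - γ k) / (v k) ^ 2 := by
      by_cases hk : v k = 0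
      · simp [t, hk]
      · simp only [t]; field_simp
    rw [this]; exact div_nonneg (h2 k) (sq_nonneg _)
  let Λ : (E × EuclideanSpace ℝ κ) →ₗ[ℝ] (E × EuclideanSpace ℝ κ) :=
    { toFun := fun z => (A z.1 + ContinuousLinearMap.adjoint B z.2,
        WithLp.toLp 2 fun k => if v k = 0 then z.2 k else B z.1 k - t k * z.2 k)
      map_add' := by
        intro z w
        ext k
        · simp only [Prod.fst_add, Prod.snd_add, map_add]; abel
        · simp only [Prod.fst_add, Prod.snd_add, map_add, PiLp.add_apply]
          split_ifs <;> ring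
      map_smul' := by
        intro s z
        ext k
        · simp
        · simp only [Prod.smul_fst, Prod.smul_snd, map_smul, PiLp.smul_apply, smul_eq_mul,
            RingHom.id_apply]
          split_ifs <;> ring }
  have hΛ : ∀ (y : E) (w δ : EuclideanSpace ℝ κ) (s : E),
      Λ (y, w) = (s, WithLp.toLp 2 fun k => if v k = 0 then 0 else δ k) →
      A y + ContinuousLinearMap.adjoint B w = s ∧ inner ℝ w δ ≤ inner ℝ w (B y) := by
    intro y w δ s h
    have h1 := congrArg Prod.fst h
    have h2 := congrArg Prod.snd h
    refine ⟨h1, ?_⟩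
    rw [PiLp.inner_apply, PiLp.inner_apply]
    refine Finset.sum_le_sum fun k _ => ?_
    have h3 : (if v k = 0 then w k else B y k - t k * w k) = if v k = 0 then 0 else δ k :=
      congrFun (congrArg WithLp.ofLp h2) k
    simp only [RCLike.inner_apply, conj_trivial]
    split_ifs at h3 with hk
    · simp [h3]
    · have : B y k * w k = δ k * w k + t k * w k ^ 2 := by rw [← h3]; ring
      have := mul_nonneg (ht k) (sq_nonneg (w k))
      linarith
  -- With zero data the constraint estimate for γ = 0 leaves only the zero solution.
  have hinj : Function.Injective Λ := by
    rw [← LinearMap.ker_eq_bot, LinearMap.ker_eq_bot']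
    rintro ⟨y, w⟩ h
    obtain ⟨h1, h2⟩ := hΛ y w 0 0 (by rw [h]; ext <;> simp)
    obtain ⟨h3, h4⟩ := saddle_bound_of_constraint ha hb hmin hmax hσ hB h1 h2
    simp only [norm_zero, zero_div, mul_zero, norm_le_zero_iff] at h3 h4
    simp [h3, h4]
  -- Superposition: (x₁, v₁) answers the data (e, 0) and (x - x₁, v - v₁) answers (0, γ). Both share
  -- the coefficients t, so each falls under one of the two preceding estimates.
  obtain ⟨⟨x₁, v₁⟩, hz⟩ := LinearMap.injective_iff_surjective.1 hinj (e, 0)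
  have hx : Λ (x, v) = (e, WithLp.toLp 2 fun k => if v k = 0 then 0 else γ k) := by
    ext k
    · exact h1
    · change (if v k = 0 then v k else B x k - t k * v k) = if v k = 0 then 0 else γ k
      split_ifs with hk
      · exact hk
      · simp only [t]; field_simp; ring
  obtain ⟨h3, h4⟩ := hΛ x₁ v₁ 0 e (by rw [hz]; ext <;> simp)
  obtain ⟨h5, h6⟩ := hΛ (x - x₁) (v - v₁) γ 0 (by
    rw [← Prod.mk_sub_mk, map_sub, hx, hz]; ext <;> simp)
  rw [inner_zero_right] at h4
  obtain ⟨p1, p2⟩ := saddle_bound_of_stationarity hA ha hb hmin hmax hσ hB h3 h4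
  obtain ⟨p3, p4⟩ := saddle_bound_of_constraint ha hb hmin hmax hσ hB h5 h6
  constructor
  · calc ‖x‖ = ‖x₁ + (x - x₁)‖ := by congr 1; abel
      _ ≤ ‖x₁‖ + ‖x - x₁‖ := norm_add_le _ _
      _ ≤ _ := add_le_add p1 p3
  · calc ‖v‖ = ‖v₁ + (v - v₁)‖ := by congr 1; abel
      _ ≤ ‖v₁‖ + ‖v - v₁‖ := norm_add_le _ _
      _ ≤ _ := add_le_add p2 p4

end LinearEstimates

/-! ### Extreme eigenvalues and the smallest singular value as bounds -/

section Spectral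

/-- A positive definite operator on a finite-dimensional space is coercive. -/
lemma exists_coercive_of_pos {E : Type*} [NormedAddCommGroup E] [InnerProductSpace ℝ E]
    [FiniteDimensional ℝ E] (A : E →L[ℝ] E) (hA : ∀ y, y ≠ 0 → 0 < inner ℝ y (A y)) :
    ∃ a > 0, ∀ y, a * ‖y‖ ^ 2 ≤ inner ℝ y (A y) := by
  have hc : Continuous fun y => inner ℝ y (A y) := by fun_prop
  rcases (Metric.sphere (0 : E) 1).eq_empty_or_nonempty with h | h
  · refine ⟨1, one_pos, fun y => ?_⟩
    have : y = 0 := by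
      by_contra hy
      have : (‖y‖⁻¹ • y) ∈ Metric.sphere (0 : E) 1 := by simp [norm_smul, hy]
      simp [h] at this
    simp [this]
  · obtain ⟨y₀, hy₀, hy⟩ := (isCompact_sphere (0 : E) 1).exists_isMinOn h hc.continuousOn
    refine ⟨inner ℝ y₀ (A y₀), hA y₀ (by rintro rfl; simp at hy₀), fun y => ?_⟩
    rcases eq_or_ne y 0 with rfl | hy0
    · simp
    have h1 : inner ℝ y₀ (A y₀) ≤ inner ℝ (‖y‖⁻¹ • y) (A (‖y‖⁻¹ • y)) :=
      hy (show (‖y‖⁻¹ • y) ∈ Metric.sphere (0 : E) 1 by simp [norm_smul, hy0])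
    have h2 : 0 < ‖y‖ := norm_pos_iff.2 hy0
    rw [map_smul, inner_smul_left, inner_smul_right, conj_trivial, ← mul_assoc, ← mul_inv, ← sq,
      ← div_eq_inv_mul, le_div_iff₀ (by positivity)] at h1
    exact h1

variable {n : ℕ} {A : EuclideanSpace ℝ (Fin n) →L[ℝ] EuclideanSpace ℝ (Fin n)}

lemma finite_hasEigenvalue : {t : ℝ | Module.End.HasEigenvalue A.toLinearMap t}.Finite :=
  Module.End.finite_hasEigenvalue A.toLinearMap

/-- The infimum of the Rayleigh quotients is itself an eigenvalue, so the least eigenvalue lies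
below every quotient. -/
lemma lamMin_mul_norm_sq_le (hA : A.toLinearMap.IsSymmetric) (y : EuclideanSpace ℝ (Fin n)) :
    lamMin A * ‖y‖ ^ 2 ≤ inner ℝ y (A y) := by
  rcases eq_or_ne y 0 with rfl | hy
  · simp
  have : Nontrivial (EuclideanSpace ℝ (Fin n)) := ⟨y, 0, hy⟩
  have h1 : lamMin A ≤ _ :=
    csInf_le finite_hasEigenvalue.bddBelow hA.hasEigenvalue_iInf_of_finiteDimensional
  have hbdd : BddBelow (range fun x : { x : EuclideanSpace ℝ (Fin n) // x ≠ 0 } =>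
      RCLike.re (inner ℝ (A.toLinearMap x) (x : EuclideanSpace ℝ (Fin n))) /
        ‖(x : EuclideanSpace ℝ (Fin n))‖ ^ 2) := by
    refine ⟨-‖A‖, ?_⟩
    rintro _ ⟨⟨x, hx⟩, rfl⟩
    have hx' : 0 < ‖x‖ := norm_pos_iff.2 hx
    simp only [ContinuousLinearMap.coe_coe, RCLike.re_to_real]
    rw [le_div_iff₀ (by positivity)]
    have h2 := real_inner_le_norm (-(A x)) x
    rw [inner_neg_left, norm_neg] at h2
    nlinarith [A.le_opNorm x]
  have h2 := h1.trans (ciInf_le hbdd ⟨y, hy⟩)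
  have hy' : 0 < ‖y‖ := norm_pos_iff.2 hy
  rw [le_div_iff₀ (by positivity), real_inner_comm] at h2
  exact h2

lemma inner_le_lamMax_mul_norm_sq (hA : A.toLinearMap.IsSymmetric)
    (y : EuclideanSpace ℝ (Fin n)) : inner ℝ y (A y) ≤ lamMax A * ‖y‖ ^ 2 := by
  rcases eq_or_ne y 0 with rfl | hy
  · simp
  have : Nontrivial (EuclideanSpace ℝ (Fin n)) := ⟨y, 0, hy⟩
  have h1 : _ ≤ lamMax A :=
    le_csSup finite_hasEigenvalue.bddAbove hA.hasEigenvalue_iSup_of_finiteDimensional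
  have hbdd : BddAbove (range fun x : { x : EuclideanSpace ℝ (Fin n) // x ≠ 0 } =>
      RCLike.re (inner ℝ (A.toLinearMap x) (x : EuclideanSpace ℝ (Fin n))) /
        ‖(x : EuclideanSpace ℝ (Fin n))‖ ^ 2) := by
    refine ⟨‖A‖, ?_⟩
    rintro _ ⟨⟨x, hx⟩, rfl⟩
    have hx' : 0 < ‖x‖ := norm_pos_iff.2 hx
    simp only [ContinuousLinearMap.coe_coe, RCLike.re_to_real]
    rw [div_le_iff₀ (by positivity)]
    have h2 := real_inner_le_norm (A x) x
    nlinarith [A.le_opNorm x]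
  have h2 := (le_ciSup hbdd ⟨y, hy⟩).trans h1
  have hy' : 0 < ‖y‖ := norm_pos_iff.2 hy
  rw [div_le_iff₀ (by positivity), real_inner_comm] at h2
  exact h2

lemma lamMin_pos [Nontrivial (EuclideanSpace ℝ (Fin n))] (hA : A.toLinearMap.IsSymmetric)
    (hpos : ∀ y, y ≠ 0 → 0 < inner ℝ y (A y)) : 0 < lamMin A := by
  have hne : {t : ℝ | Module.End.HasEigenvalue A.toLinearMap t}.Nonempty :=
    ⟨_, hA.hasEigenvalue_iInf_of_finiteDimensional⟩
  obtain ⟨y, hy⟩ := Module.End.HasEigenvalue.exists_hasEigenvector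
    (hne.csInf_mem finite_hasEigenvalue)
  have h1 := hpos y hy.2
  have h2 : A y = lamMin A • y := hy.apply_eq_smul
  rw [h2, inner_smul_right, real_inner_self_eq_norm_sq] at h1
  by_contra! h
  nlinarith [sq_nonneg ‖y‖]

lemma lamMin_le_lamMax [Nontrivial (EuclideanSpace ℝ (Fin n))] (hA : A.toLinearMap.IsSymmetric) :
    lamMin A ≤ lamMax A := by
  obtain ⟨y, hy⟩ := exists_ne (0 : EuclideanSpace ℝ (Fin n))
  have hy' : 0 < ‖y‖ := norm_pos_iff.2 hy
  exact le_of_mul_le_mul_right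
    ((lamMin_mul_norm_sq_le hA y).trans (inner_le_lamMax_mul_norm_sq hA y)) (by positivity)

/-- This is A² ≤ λmax A. It comes from positivity of A at λmax y - A y combined with the Rayleigh
bound at A y, so no square root of A is needed. -/
lemma norm_apply_sq_le_lamMax_mul [Nontrivial (EuclideanSpace ℝ (Fin n))]
    (hA : A.toLinearMap.IsSymmetric)
    (hpos : ∀ y, y ≠ 0 → 0 < inner ℝ y (A y)) (y : EuclideanSpace ℝ (Fin n)) :
    ‖A y‖ ^ 2 ≤ lamMax A * inner ℝ y (A y) := by
  have hM : 0 < lamMax A := (lamMin_pos hA hpos).trans_le (lamMin_le_lamMax hA)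
  have h0 : ∀ z, 0 ≤ inner ℝ z (A z) := fun z => by
    rcases eq_or_ne z 0 with rfl | hz
    · simp
    · exact (hpos z hz).le
  have h1 := h0 (lamMax A • y - A y)
  have h2 := inner_le_lamMax_mul_norm_sq hA (A y)
  have h3 : inner ℝ y (A (A y)) = ‖A y‖ ^ 2 := by
    rw [← real_inner_self_eq_norm_sq]; exact (hA y (A y)).symm
  simp only [map_sub, map_smul, inner_sub_left, inner_sub_right, inner_smul_left,
    inner_smul_right, conj_trivial, h3, real_inner_self_eq_norm_sq] at h1
  have h4 : 0 ≤ lamMax A * (lamMax A * inner ℝ y (A y) - ‖A y‖ ^ 2) := by nlinarith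
  exact sub_nonneg.1 (nonneg_of_mul_nonneg_right h4 hM)

variable {ι κ : Type*} [Fintype ι] [Fintype κ]
  {T : EuclideanSpace ℝ ι →L[ℝ] EuclideanSpace ℝ κ}

lemma min_card_sub_one_of_injective (hT : Function.Injective T) :
    min (Fintype.card ι) (Fintype.card κ) - 1 = Fintype.card ι - 1 := by
  have h := LinearMap.finrank_le_finrank_of_injective (f := T.toLinearMap) hT
  simp only [finrank_euclideanSpace] at h
  rw [min_eq_left h]

lemma sigmaMin_pos [Nonempty ι] (hT : Function.Injective T) : 0 < sigmaMin T := by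
  rw [sigmaMin, min_card_sub_one_of_injective hT]
  refine (LinearMap.injective_iff_forall_lt_finrank_singularValues_pos _).1 hT _ ?_
  rw [finrank_euclideanSpace]
  exact Nat.sub_lt Fintype.card_pos one_pos

/-- Expand v in an eigenbasis of T*T, whose eigenvalues are the squared singular values. Injectivity
ensures that the index in `sigmaMin` is the last one of the domain, hence that of the least
eigenvalue. -/
lemma sigmaMin_mul_norm_le (hT : Function.Injective T) (v : EuclideanSpace ℝ ι) :
    sigmaMin T * ‖v‖ ≤ ‖T v‖ := by
  rcases isEmpty_or_nonempty ι with hι | hι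
  · simp [Subsingleton.elim v 0]
  have hd : Module.finrank ℝ (EuclideanSpace ℝ ι) = Fintype.card ι := finrank_euclideanSpace
  set S := T.toLinearMap.adjoint ∘ₗ T.toLinearMap with hS
  have hsym : S.IsSymmetric := T.toLinearMap.isSymmetric_adjoint_comp_self
  let bs := hsym.eigenvectorBasis hd
  have hs : ∀ i, sigmaMin T ^ 2 ≤ hsym.eigenvalues hd i := by
    intro i
    rw [sigmaMin, min_card_sub_one_of_injective hT,
      T.toLinearMap.sq_singularValues_of_lt hd (Nat.sub_lt Fintype.card_pos one_pos)]
    refine hsym.eigenvalues_antitone hd ?_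
    rw [Fin.le_def]
    have := i.2
    simp only
    omega
  have h1 : inner ℝ v (S v) = ∑ i, hsym.eigenvalues hd i * inner ℝ v (bs i) ^ 2 := by
    rw [← bs.sum_inner_mul_inner v (S v)]
    refine Finset.sum_congr rfl fun i _ => ?_
    rw [← hsym (bs i) v, hsym.apply_eigenvectorBasis hd i]
    simp only [RCLike.ofReal_real_eq_id, id, inner_smul_left, conj_trivial]
    rw [real_inner_comm v (hsym.eigenvectorBasis hd i)]
    simp only [bs]; ring
  have h2 : ‖v‖ ^ 2 = ∑ i, inner ℝ v (bs i) ^ 2 := by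
    rw [← real_inner_self_eq_norm_sq, ← bs.sum_inner_mul_inner v v]
    refine Finset.sum_congr rfl fun i _ => ?_
    rw [real_inner_comm v (bs i)]; ring
  have h3 : inner ℝ v (S v) = ‖T v‖ ^ 2 := by
    rw [← real_inner_self_eq_norm_sq, hS, LinearMap.comp_apply, LinearMap.adjoint_inner_right]
    rfl
  refine le_of_sq_le_sq ?_ (norm_nonneg _)
  rw [mul_pow, ← h3, h1, h2, Finset.mul_sum]
  exact Finset.sum_le_sum fun i _ => mul_le_mul_of_nonneg_right (hs i) (sq_nonneg _)

end Spectral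

/-! ### Lipschitz estimate for the reduced KKT system -/

lemma exists_mul_le {C δ : ℝ} (hC : 0 < C) (hδ : 0 < δ) :
    ∃ ε > 0, C * ε ≤ 1 / 2 ∧ C * ε ≤ δ := by
  refine ⟨min (1 / 2) δ / C, by positivity, ?_, ?_⟩
  · rw [mul_div_cancel₀ _ hC.ne']; exact min_le_left _ _
  · rw [mul_div_cancel₀ _ hC.ne']; exact min_le_right _ _

/-- The KKT system in which all inequality constraints that enter are active at the base point:
`Ψ` is the gradient of the Lagrangian, `c` the vector of constraints, and `Q` is the set of indices
of the inequality constraints. -/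
structure ReducedKKT {E R κ : Type*} [Zero E] (Q : Set κ)
    (Ψ : (EuclideanSpace ℝ κ × R) × E → E) (c : E × R → EuclideanSpace ℝ κ)
    (x : E) (v : EuclideanSpace ℝ κ) (ξ : R) : Prop where
  stationary : Ψ ((v, ξ), x) = 0
  eq_zero : ∀ k ∉ Q, c (x, ξ) k = 0
  nonpos : ∀ k ∈ Q, c (x, ξ) k ≤ 0
  nonneg : ∀ k ∈ Q, 0 ≤ v k
  compl : ∀ k ∈ Q, v k * c (x, ξ) k = 0

namespace ReducedKKT

/-- Multipliers and constraint values of two solutions differ with the same signs. -/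
lemma mul_sub_nonneg {E R κ : Type*} [Zero E] {Q : Set κ}
    {Ψ : (EuclideanSpace ℝ κ × R) × E → E} {c : E × R → EuclideanSpace ℝ κ}
    {x x' : E} {v v' : EuclideanSpace ℝ κ} {ξ ξ' : R}
    (h : ReducedKKT Q Ψ c x v ξ) (h' : ReducedKKT Q Ψ c x' v' ξ') (k : κ) :
    0 ≤ (v - v') k * (c (x, ξ) k - c (x', ξ') k) := by
  by_cases hk : k ∈ Q
  · have h1 := mul_nonpos_of_nonneg_of_nonpos (h.nonneg k hk) (h'.nonpos k hk)
    have h2 := mul_nonpos_of_nonneg_of_nonpos (h'.nonneg k hk) (h.nonpos k hk)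
    have h3 := h.compl k hk
    have h4 := h'.compl k hk
    rw [PiLp.sub_apply]
    linarith
  · simp [h.eq_zero k hk, h'.eq_zero k hk]

variable {E R : Type*} [NormedAddCommGroup E] [InnerProductSpace ℝ E] [FiniteDimensional ℝ E]
  [NormedAddCommGroup R] [NormedSpace ℝ R] {κ : Type*} [Fintype κ] {Q : Set κ}
  {Ψ : (EuclideanSpace ℝ κ × R) × E → E} {c : E × R → EuclideanSpace ℝ κ}
  {x₀ : E} {v₀ : EuclideanSpace ℝ κ} {ξ₀ : R}
  {A : E →L[ℝ] E} {B : E →L[ℝ] EuclideanSpace ℝ κ} {L : R →L[ℝ] E}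
  {G : R →L[ℝ] EuclideanSpace ℝ κ} {a b σ : ℝ}
  {Ψ' : ((EuclideanSpace ℝ κ × R) × E) →L[ℝ] E} {c' : (E × R) →L[ℝ] EuclideanSpace ℝ κ}

/-- Solutions of the reduced KKT system near the base point depend on the parameter in a Lipschitz
way, and the constants are those of the linearized system. -/
theorem exists_lipschitz_nhds (hΨ : HasStrictFDerivAt Ψ Ψ' ((v₀, ξ₀), x₀))
    (hΨ' : ∀ w d y, Ψ' ((w, d), y) = A y + ContinuousLinearMap.adjoint B w + L d)
    (hc : HasStrictFDerivAt c c' (x₀, ξ₀)) (hc' : ∀ y d, c' (y, d) = B y + G d)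
    (hA : ∀ y z, inner ℝ (A y) z = inner ℝ y (A z)) (ha : 0 < a) (hb : 0 < b)
    (hmin : ∀ y, a * ‖y‖ ^ 2 ≤ inner ℝ y (A y))
    (hmax : ∀ y, ‖A y‖ ^ 2 ≤ b * inner ℝ y (A y)) (hσ : 0 < σ)
    (hB : ∀ v, σ * ‖v‖ ≤ ‖ContinuousLinearMap.adjoint B v‖)
    {ℓ ℓ' : ℝ} (hℓ : ‖L‖ / a + √(b / a) * (‖G‖ / σ) < ℓ)
    (hℓ' : b / a * ‖L‖ / σ + b * ‖G‖ / σ ^ 2 < ℓ') :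
    ∃ W ∈ 𝓝 ((v₀, ξ₀), x₀), ∀ x v ξ x' v' ξ', ((v, ξ), x) ∈ W → ((v', ξ'), x') ∈ W →
      ReducedKKT Q Ψ c x v ξ → ReducedKKT Q Ψ c x' v' ξ' →
        ‖x - x'‖ ≤ ℓ * ‖ξ - ξ'‖ ∧ ‖v - v'‖ ≤ ℓ' * ‖ξ - ξ'‖ := by
  set k₁ := ‖L‖ / a + √(b / a) * (‖G‖ / σ) with hk₁
  set k₂ := b / a * ‖L‖ / σ + b * ‖G‖ / σ ^ 2 with hk₂
  have hk₁0 : 0 ≤ k₁ := by positivity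
  have hk₂0 : 0 ≤ k₂ := by positivity
  set C₁ := 1 / a + √(b / a) * (1 / σ) with hC₁
  set C₂ := b / a / σ + b / σ ^ 2 with hC₂
  have hC₁0 : 0 < C₁ := by positivity
  have hC₂0 : 0 < C₂ := by positivity
  set K := k₁ + k₂ + 1 with hK
  have hK1 : 1 ≤ K := by linarith
  -- The first bound on ε absorbs the linearization error into the left side; the second makes the
  -- remaining error fit into the gaps ℓ - k₁ and ℓ' - k₂.
  obtain ⟨ε, hε, hε1, hε2⟩ := exists_mul_le (C := 2 * K * (C₁ + C₂)) (δ := min (ℓ - k₁) (ℓ' - k₂))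
    (by positivity) (lt_min (by linarith) (by linarith))
  have hΨε := hΨ.isLittleO.def hε
  have hcε := hc.isLittleO.def hε
  have hpc : Tendsto (fun z : ((EuclideanSpace ℝ κ × R) × E) => (z.2, z.1.2))
      (𝓝 ((v₀, ξ₀), x₀)) (𝓝 (x₀, ξ₀)) :=
    (by fun_prop : Continuous fun z : ((EuclideanSpace ℝ κ × R) × E) => (z.2, z.1.2)).tendsto _
  rw [nhds_prod_eq, eventually_prod_self_iff'] at hΨε hcε
  obtain ⟨W₁, hW₁, h₁⟩ := hΨε
  obtain ⟨W₂, hW₂, h₂⟩ := hcε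
  refine ⟨W₁ ∩ (fun z : ((EuclideanSpace ℝ κ × R) × E) => (z.2, z.1.2)) ⁻¹' W₂,
    inter_mem hW₁ (hpc hW₂), ?_⟩
  rintro x v ξ x' v' ξ' ⟨hz, hz2⟩ ⟨hz', hz2'⟩ h h'
  set s := ‖x - x'‖ + ‖v - v'‖ + ‖ξ - ξ'‖ with hs
  have n1 := norm_nonneg (x - x')
  have n2 := norm_nonneg (v - v')
  have n3 := norm_nonneg (ξ - ξ')
  have e1 : ‖A (x - x') + ContinuousLinearMap.adjoint B (v - v')‖ ≤ ‖L‖ * ‖ξ - ξ'‖ + ε * s := by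
    have := h₁ _ hz _ hz'
    rw [h.stationary, h'.stationary, Prod.mk_sub_mk, Prod.mk_sub_mk, hΨ', sub_self, zero_sub,
      norm_neg] at this
    have hle : ‖((v - v', ξ - ξ'), x - x')‖ ≤ s := by
      refine max_le (max_le ?_ ?_) ?_ <;> simp only [hs] <;> linarith
    calc _ = ‖(A (x - x') + ContinuousLinearMap.adjoint B (v - v') + L (ξ - ξ'))
          - L (ξ - ξ')‖ := by congr 1; abel
      _ ≤ _ := norm_sub_le _ _
      _ ≤ ε * s + ‖L‖ * ‖ξ - ξ'‖ := add_le_add (this.trans (by gcongr)) (L.le_opNorm _)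
      _ = _ := add_comm _ _
  -- With this choice B (x - x') - γ is exactly the difference of the constraint values, so the sign
  -- condition holds without error; the linearization error only enters ‖γ‖.
  set γ := B (x - x') - (c (x, ξ) - c (x', ξ')) with hγ
  have e2 : ‖γ‖ ≤ ‖G‖ * ‖ξ - ξ'‖ + ε * s := by
    have := h₂ _ hz2 _ hz2'
    rw [Prod.mk_sub_mk, hc'] at this
    have hle : ‖(x - x', ξ - ξ')‖ ≤ s := by
      refine max_le ?_ ?_ <;> simp only [hs] <;> linarith
    calc ‖γ‖ = ‖-(G (ξ - ξ')) -
          (c (x, ξ) - c (x', ξ') - (B (x - x') + G (ξ - ξ')))‖ := by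
          rw [hγ]; congr 1; abel
      _ ≤ _ := norm_sub_le _ _
      _ ≤ ‖G‖ * ‖ξ - ξ'‖ + ε * s := by
          rw [norm_neg]
          exact add_le_add (G.le_opNorm _) (this.trans (by gcongr))
  obtain ⟨p1, p2⟩ := saddle_bound hA ha hb hmin hmax hσ hB (x := x - x') (v := v - v') (γ := γ) rfl
    (fun k => by
      have := mul_sub_nonneg h h' k
      simpa [hγ] using this)
  have q1 : ‖x - x'‖ ≤ k₁ * ‖ξ - ξ'‖ + C₁ * (ε * s) := by
    refine p1.trans ?_
    calc _ ≤ (‖L‖ * ‖ξ - ξ'‖ + ε * s) / a + √(b / a) * ((‖G‖ * ‖ξ - ξ'‖ + ε * s) / σ) := by gcongr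
      _ = _ := by rw [hk₁, hC₁]; ring
  have q2 : ‖v - v'‖ ≤ k₂ * ‖ξ - ξ'‖ + C₂ * (ε * s) := by
    refine p2.trans ?_
    calc _ ≤ b / a * (‖L‖ * ‖ξ - ξ'‖ + ε * s) / σ + b * (‖G‖ * ‖ξ - ξ'‖ + ε * s) / σ ^ 2 := by
          gcongr
      _ = _ := by rw [hk₂, hC₂]; ring
  have hs0 : 0 ≤ s := by positivity
  have hCε : (C₁ + C₂) * ε ≤ 1 / 2 := by
    have : (C₁ + C₂) * ε ≤ 2 * K * ((C₁ + C₂) * ε) :=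
      le_mul_of_one_le_left (by positivity) (by linarith)
    linarith
  -- Summing the two bounds gives s ≤ K ‖ξ - ξ'‖ + s/2, a crude Lipschitz bound. Fed back into the
  -- error terms, it yields the sharp constants.
  have hsK : s ≤ 2 * K * ‖ξ - ξ'‖ := by
    have h5 : s ≤ K * ‖ξ - ξ'‖ + (C₁ + C₂) * ε * s := by
      rw [hK]; linarith
    have h6 : (C₁ + C₂) * ε * s ≤ 1 / 2 * s := by gcongr
    linarith
  have hfin : ∀ C' k' l', 0 < C' → C' ≤ C₁ + C₂ → 2 * K * (C₁ + C₂) * ε ≤ l' - k' →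
      k' * ‖ξ - ξ'‖ + C' * (ε * s) ≤ l' * ‖ξ - ξ'‖ := by
    intro C' k' l' hC' hCC hl
    have : C' * (ε * s) ≤ (l' - k') * ‖ξ - ξ'‖ := by
      calc C' * (ε * s) ≤ (C₁ + C₂) * (ε * (2 * K * ‖ξ - ξ'‖)) := by gcongr
        _ = 2 * K * (C₁ + C₂) * ε * ‖ξ - ξ'‖ := by ring
        _ ≤ _ := by gcongr
    linarith
  exact ⟨q1.trans (hfin _ _ _ hC₁0 (by linarith) (hε2.trans (min_le_left _ _))),
    q2.trans (hfin _ _ _ hC₂0 (by linarith) (hε2.trans (min_le_right _ _)))⟩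

end ReducedKKT

/-! ### Solvability by projected dual ascent -/

open Classical in
/-- Projection of `ℝ^κ` onto the cone of vectors that are nonnegative on `Q`. -/
noncomputable def coneProj {κ : Type*} (Q : Set κ) (w : EuclideanSpace ℝ κ) :
    EuclideanSpace ℝ κ :=
  WithLp.toLp 2 fun k => if k ∈ Q then max (w k) 0 else w k

lemma coneProj_apply_of_mem {κ : Type*} {Q : Set κ} (w : EuclideanSpace ℝ κ) {k : κ}
    (hk : k ∈ Q) : coneProj Q w k = max (w k) 0 := by
  simp [coneProj, hk]

lemma coneProj_apply_of_notMem {κ : Type*} {Q : Set κ} (w : EuclideanSpace ℝ κ) {k : κ}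
    (hk : k ∉ Q) : coneProj Q w k = w k := by
  simp [coneProj, hk]

lemma norm_coneProj_sub_le {κ : Type*} [Fintype κ] (Q : Set κ) (w w' : EuclideanSpace ℝ κ) :
    ‖coneProj Q w - coneProj Q w'‖ ≤ ‖w - w'‖ := by
  rw [EuclideanSpace.norm_eq, EuclideanSpace.norm_eq]
  refine Real.sqrt_le_sqrt (Finset.sum_le_sum fun k _ => ?_)
  refine pow_le_pow_left₀ (norm_nonneg _) ?_ 2
  simp only [PiLp.sub_apply, Real.norm_eq_abs]
  by_cases hk : k ∈ Q
  · rw [coneProj_apply_of_mem _ hk, coneProj_apply_of_mem _ hk]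
    exact abs_max_sub_max_le_abs _ _ _
  · rw [coneProj_apply_of_notMem _ hk, coneProj_apply_of_notMem _ hk]

/-- A dissipative operator becomes a contraction after a small forward step. -/
lemma exists_norm_add_smul_le {V : Type*} [NormedAddCommGroup V] [InnerProductSpace ℝ V]
    (S : V →L[ℝ] V) {s : ℝ} (hs : 0 < s) (hS : ∀ w, inner ℝ w (S w) ≤ -(s * ‖w‖ ^ 2)) :
    ∃ ρ : ℝ, 0 < ρ ∧ ∃ q : ℝ, 0 < q ∧ q < 1 ∧ ∀ w, ‖w + ρ • S w‖ ≤ (1 - q) * ‖w‖ := by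
  -- The summand s² keeps D positive and gives ρ s ≤ 1 for ρ = s / D. The squared factor is then at
  -- most 1 - 2ρs + ρ²D = 1 - ρs ≤ (1 - ρs/2)².
  set D := ‖S‖ ^ 2 + s ^ 2 with hD
  have hD0 : 0 < D := by positivity
  set ρ := s / D with hρ
  have hρ0 : 0 < ρ := by positivity
  have hρD : ρ * D = s := by rw [hρ]; field_simp
  have hρs : ρ * s ≤ 1 := by
    rw [hρ, div_mul_eq_mul_div, div_le_one hD0, hD]; nlinarith [sq_nonneg ‖S‖]
  refine ⟨ρ, hρ0, ρ * s / 2, by positivity, by linarith, fun w => ?_⟩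
  refine le_of_sq_le_sq ?_ (mul_nonneg (by linarith) (norm_nonneg _))
  rw [norm_add_sq_real, inner_smul_right, norm_smul, mul_pow, mul_pow, Real.norm_eq_abs, sq_abs]
  have h1 : ‖S w‖ ^ 2 ≤ ‖S‖ ^ 2 * ‖w‖ ^ 2 := by
    rw [← mul_pow]; exact pow_le_pow_left₀ (norm_nonneg _) (S.le_opNorm w) 2
  have h2 : ρ ^ 2 * ‖S w‖ ^ 2 ≤ ρ * s * ‖w‖ ^ 2 := by
    calc ρ ^ 2 * ‖S w‖ ^ 2 ≤ ρ ^ 2 * (‖S‖ ^ 2 * ‖w‖ ^ 2) := by gcongr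
      _ ≤ ρ ^ 2 * (D * ‖w‖ ^ 2) := by gcongr; rw [hD]; nlinarith
      _ = ρ * (ρ * D) * ‖w‖ ^ 2 := by ring
      _ = _ := by rw [hρD]
  have h3 : ρ * inner ℝ w (S w) ≤ ρ * -(s * ‖w‖ ^ 2) := by gcongr; exact hS w
  nlinarith [sq_nonneg (ρ * s * ‖w‖)]

/-- A map that contracts on a closed ball and moves the center only a little has a fixed point in
that ball. -/
lemma exists_fixedPoint_closedBall {V : Type*} [NormedAddCommGroup V] [CompleteSpace V]
    {T : V → V} {v₀ : V} {ρ q : ℝ} (hρ : 0 ≤ ρ) (hq : 0 < q) (hq1 : q < 1)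
    (hT : ∀ v ∈ Metric.closedBall v₀ ρ, ∀ v' ∈ Metric.closedBall v₀ ρ,
      ‖T v - T v'‖ ≤ (1 - q) * ‖v - v'‖) (h₀ : ‖T v₀ - v₀‖ ≤ q * ρ) :
    ∃ v ∈ Metric.closedBall v₀ ρ, T v = v := by
  have hmem : v₀ ∈ Metric.closedBall v₀ ρ := Metric.mem_closedBall_self hρ
  have hmaps : MapsTo T (Metric.closedBall v₀ ρ) (Metric.closedBall v₀ ρ) := by
    intro v hv
    have h1 := hT v hv v₀ hmem
    rw [mem_closedBall_iff_norm] at hv ⊢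
    calc ‖T v - v₀‖ = ‖(T v - T v₀) + (T v₀ - v₀)‖ := by congr 1; abel
      _ ≤ (1 - q) * ‖v - v₀‖ + q * ρ := (norm_add_le _ _).trans (add_le_add h1 h₀)
      _ ≤ (1 - q) * ρ + q * ρ := by gcongr
      _ = ρ := by ring
  have hcontr : ContractingWith (1 - q).toNNReal (hmaps.restrict T _ _) := by
    refine ⟨by rw [← NNReal.coe_lt_coe, Real.coe_toNNReal _ (by linarith)]; simpa using hq, ?_⟩
    refine LipschitzWith.of_dist_le_mul fun v v' => ?_
    rw [Real.coe_toNNReal _ (by linarith), Subtype.dist_eq, Subtype.dist_eq, dist_eq_norm,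
      dist_eq_norm]
    exact hT v v.2 v' v'.2
  obtain ⟨v, hv, hfix, -⟩ := ContractingWith.exists_fixedPoint'
    Metric.isClosed_closedBall.isComplete hmaps hcontr hmem (edist_ne_top _ _)
  exact ⟨v, hv, hfix⟩

namespace ReducedKKT

variable {E R : Type*} [NormedAddCommGroup E] [InnerProductSpace ℝ E] [FiniteDimensional ℝ E]
  [NormedAddCommGroup R] [NormedSpace ℝ R] [CompleteSpace R] {κ : Type*} [Fintype κ] {Q : Set κ}
  {Ψ : (EuclideanSpace ℝ κ × R) × E → E} {c : E × R → EuclideanSpace ℝ κ}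
  {x₀ : E} {v₀ : EuclideanSpace ℝ κ} {ξ₀ : R}
  {A : E →L[ℝ] E} {B : E →L[ℝ] EuclideanSpace ℝ κ} {L : R →L[ℝ] E}
  {G : R →L[ℝ] EuclideanSpace ℝ κ} {a b σ : ℝ}
  {Ψ' : ((EuclideanSpace ℝ κ × R) × E) →L[ℝ] E} {c' : (E × R) →L[ℝ] EuclideanSpace ℝ κ}

/-- Elimination of the primal variable from the stationarity equation. -/
lemma exists_stationary_map (hΨ : HasStrictFDerivAt Ψ Ψ' ((v₀, ξ₀), x₀))
    (hΨ' : ∀ w d y, Ψ' ((w, d), y) = A y + ContinuousLinearMap.adjoint B w + L d)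
    (ha : 0 < a) (hmin : ∀ y, a * ‖y‖ ^ 2 ≤ inner ℝ y (A y))
    (h₀ : Ψ ((v₀, ξ₀), x₀) = 0) :
    ∃ (X : EuclideanSpace ℝ κ × R → E) (X' : (EuclideanSpace ℝ κ × R) →L[ℝ] E),
      X (v₀, ξ₀) = x₀ ∧ HasStrictFDerivAt X X' (v₀, ξ₀) ∧
      (∀ᶠ z in 𝓝 (v₀, ξ₀), Ψ (z, X z) = 0) ∧
      ∀ w, A (X' (w, 0)) = -ContinuousLinearMap.adjoint B w := by
  have hsurj := surjective_of_coercive ha hmin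
  have hinj : Function.Injective A.toLinearMap := LinearMap.injective_iff_surjective.2 hsurj
  let e : E ≃L[ℝ] E := (LinearEquiv.ofBijective A.toLinearMap ⟨hinj, hsurj⟩).toContinuousLinearEquiv
  have he : (e : E →L[ℝ] E) = Ψ' ∘L .inr ℝ (EuclideanSpace ℝ κ × R) E := by
    ext y
    have := hΨ' 0 0 y
    simp only [map_zero, add_zero] at this
    exact this.symm
  have hinv : (Ψ' ∘L .inr ℝ (EuclideanSpace ℝ κ × R) E).IsInvertible := ⟨e, he⟩
  refine ⟨hΨ.implicitFunctionOfProdDomain hinv, _, ?_,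
    hΨ.hasStrictFDerivAt_implicitFunctionOfProdDomain hinv, ?_, fun w => ?_⟩
  · exact (hΨ.eventually_apply_eq_iff_implicitFunctionOfProdDomain hinv).self_of_nhds.1 rfl
  · filter_upwards [hΨ.eventually_apply_implicitFunctionOfProdDomain hinv] with z hz
    rw [hz, h₀]
  · rw [← he, ContinuousLinearMap.inverse_equiv]
    have h1 : Ψ' ((w, 0), 0) = ContinuousLinearMap.adjoint B w := by simp [hΨ']
    have h2 : ∀ y, A (e.symm y) = y := fun y => e.apply_symm_apply y
    simp [h1, h2]

/-- Solvability of the reduced KKT system near the base point. -/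
theorem eventually_exists (hΨ : HasStrictFDerivAt Ψ Ψ' ((v₀, ξ₀), x₀))
    (hΨ' : ∀ w d y, Ψ' ((w, d), y) = A y + ContinuousLinearMap.adjoint B w + L d)
    (hc : HasStrictFDerivAt c c' (x₀, ξ₀)) (hc' : ∀ y d, c' (y, d) = B y + G d)
    (ha : 0 < a) (hb : 0 < b)
    (hmin : ∀ y, a * ‖y‖ ^ 2 ≤ inner ℝ y (A y))
    (hmax : ∀ y, ‖A y‖ ^ 2 ≤ b * inner ℝ y (A y)) (hσ : 0 < σ)
    (hB : ∀ v, σ * ‖v‖ ≤ ‖ContinuousLinearMap.adjoint B v‖)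
    (h₀ : ReducedKKT Q Ψ c x₀ v₀ ξ₀) {W : Set ((EuclideanSpace ℝ κ × R) × E)}
    (hW : W ∈ 𝓝 ((v₀, ξ₀), x₀)) :
    ∀ᶠ ξ in 𝓝 ξ₀, ∃ x v, ((v, ξ), x) ∈ W ∧ ReducedKKT Q Ψ c x v ξ := by
  obtain ⟨X, X', hX₀, hX, hXΨ, hX'⟩ := exists_stationary_map hΨ hΨ' ha hmin h₀.stationary
  let Φ : EuclideanSpace ℝ κ × R → EuclideanSpace ℝ κ := fun z => c (X z, z.2)
  have hΦ : HasStrictFDerivAt Φ (c' ∘L X'.prod (.snd ℝ _ _)) (v₀, ξ₀) := by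
    rw [← hX₀] at hc
    exact hc.comp (v₀, ξ₀) (hX.prodMk hasStrictFDerivAt_snd)
  let S : EuclideanSpace ℝ κ →L[ℝ] EuclideanSpace ℝ κ := B ∘L X' ∘L .inl ℝ _ _
  -- S = -B A⁻¹ Bᵀ, and ⟨w, S w⟩ = -⟨y, A y⟩ for y = X' (w, 0) with A y = -Bᵀ w. The upper bound on
  -- A and the lower bound on Bᵀ give the modulus σ² / b.
  have hS : ∀ w, inner ℝ w (S w) ≤ -(σ ^ 2 / b * ‖w‖ ^ 2) := by
    intro w
    have h1 : inner ℝ w (S w) = -inner ℝ (X' (w, 0)) (A (X' (w, 0))) := by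
      rw [hX', inner_neg_right, neg_neg, ContinuousLinearMap.adjoint_inner_right, real_inner_comm]
      rfl
    have h2 := hmax (X' (w, 0))
    rw [hX' w, norm_neg, ← hX' w] at h2
    have h3 : (σ * ‖w‖) ^ 2 ≤ b * inner ℝ (X' (w, 0)) (A (X' (w, 0))) :=
      (pow_le_pow_left₀ (by positivity) (hB w) 2).trans h2
    rw [h1, neg_le_neg_iff, div_mul_eq_mul_div, div_le_iff₀ hb]
    linarith
  obtain ⟨ρ, hρ, q, hq, hq1, hρS⟩ := exists_norm_add_smul_le S (by positivity) hS
  -- One projected ascent step. A fixed point encodes Φ_k = 0 off Q and, on Q, v_k ≥ 0, Φ_k ≤ 0, v_k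
  -- Φ_k = 0.
  let T : R → EuclideanSpace ℝ κ → EuclideanSpace ℝ κ := fun ξ v => coneProj Q (v + ρ • Φ (v, ξ))
  have hfix : ∀ ξ v, T ξ v = v → Ψ ((v, ξ), X (v, ξ)) = 0 → ReducedKKT Q Ψ c (X (v, ξ)) v ξ := by
    intro ξ v hv hst
    have hQ : ∀ k ∈ Q, max (v k + ρ * Φ (v, ξ) k) 0 = v k := fun k hk =>
      (coneProj_apply_of_mem (v + ρ • Φ (v, ξ)) hk).symm.trans
        (congrFun (congrArg WithLp.ofLp hv) k)
    refine ⟨hst, fun k hk => ?_, fun k hk => ?_, fun k hk => ?_, fun k hk => ?_⟩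
    · have h1 : v k + ρ * Φ (v, ξ) k = v k :=
        (coneProj_apply_of_notMem (v + ρ • Φ (v, ξ)) hk).symm.trans
          (congrFun (congrArg WithLp.ofLp hv) k)
      have h2 : ρ * Φ (v, ξ) k = 0 := by linarith
      exact (mul_eq_zero.1 h2).resolve_left hρ.ne'
    · have h1 := le_max_left (v k + ρ * Φ (v, ξ) k) 0
      rw [hQ k hk] at h1
      have h2 : ρ * Φ (v, ξ) k ≤ 0 := by linarith
      exact nonpos_of_mul_nonpos_right h2 hρ
    · rw [← hQ k hk]; exact le_max_right _ _
    · have h1 := hQ k hk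
      rcases max_choice (v k + ρ * Φ (v, ξ) k) 0 with h | h
      · rw [h] at h1
        have h2 : ρ * Φ (v, ξ) k = 0 := by linarith
        rw [show c (X (v, ξ), ξ) k = 0 from (mul_eq_zero.1 h2).resolve_left hρ.ne', mul_zero]
      · rw [← h1, h, zero_mul]
  have hT₀ : T ξ₀ v₀ = v₀ := by
    have hΦ₀ : Φ (v₀, ξ₀) = c (x₀, ξ₀) := by simp only [Φ, hX₀]
    ext k
    by_cases hk : k ∈ Q
    · refine (coneProj_apply_of_mem _ hk).trans ?_
      rw [hΦ₀]
      simp only [PiLp.add_apply, PiLp.smul_apply, smul_eq_mul]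
      have h1 := h₀.nonneg k hk
      have h2 := h₀.nonpos k hk
      rcases mul_eq_zero.1 (h₀.compl k hk) with h | h
      · rw [h, zero_add]
        exact max_eq_right (mul_nonpos_of_nonneg_of_nonpos hρ.le h2)
      · rw [h, mul_zero, add_zero]; exact max_eq_left h1
    · refine (coneProj_apply_of_notMem _ hk).trans ?_
      rw [hΦ₀]
      simp [h₀.eq_zero k hk]
  -- After multiplication by ρ, the nonlinear remainder costs q / 2 of the contraction margin q,
  -- leaving the factor 1 - q / 2.
  have hΦε := hΦ.isLittleO.def (show 0 < q / 2 / ρ by positivity)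
  rw [nhds_prod_eq, eventually_prod_self_iff'] at hΦε
  obtain ⟨W₁, hW₁, hlip⟩ := hΦε
  have hW₂ : ∀ᶠ z in 𝓝 (v₀, ξ₀), (z, X z) ∈ W := by
    have : ContinuousAt (fun z => (z, X z)) (v₀, ξ₀) := continuousAt_id.prodMk hX.continuousAt
    rw [← hX₀] at hW
    exact this hW
  have hall : ∀ᶠ z in 𝓝 (v₀, ξ₀), z ∈ W₁ ∧ (z, X z) ∈ W ∧ Ψ (z, X z) = 0 := by
    filter_upwards [hW₁, hW₂, hXΨ] with z h1 h2 h3 using ⟨h1, h2, h3⟩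
  rw [nhds_prod_eq, eventually_prod_iff] at hall
  obtain ⟨p, hp, p', hp', hpp⟩ := hall
  obtain ⟨δ, hδ, hball⟩ := Metric.nhds_basis_closedBall.eventually_iff.1 hp
  -- The radius δ in the multiplier is fixed independently of ξ; only the displacement of the center
  -- v₀ has to be made small by taking ξ close to ξ₀.
  have hmove : ∀ᶠ ξ in 𝓝 ξ₀, ‖T ξ v₀ - v₀‖ ≤ q / 2 * δ := by
    have hcont : ContinuousAt (fun ξ => Φ (v₀, ξ)) ξ₀ :=
      ContinuousAt.comp (f := fun ξ => (v₀, ξ)) hΦ.continuousAt (by fun_prop)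
    have h1 : Tendsto (fun ξ => ‖(v₀ + ρ • Φ (v₀, ξ)) - (v₀ + ρ • Φ (v₀, ξ₀))‖) (𝓝 ξ₀) (𝓝 0) := by
      have : ContinuousAt (fun ξ => ‖(v₀ + ρ • Φ (v₀, ξ)) - (v₀ + ρ • Φ (v₀, ξ₀))‖) ξ₀ :=
        ((continuousAt_const.add (hcont.const_smul ρ)).sub continuousAt_const).norm
      simpa [ContinuousAt] using this
    filter_upwards [h1.eventually_le_const (show 0 < q / 2 * δ by positivity)] with ξ hξ
    calc ‖T ξ v₀ - v₀‖ = ‖T ξ v₀ - T ξ₀ v₀‖ := by rw [hT₀]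
      _ ≤ _ := norm_coneProj_sub_le _ _ _
      _ ≤ _ := hξ
  filter_upwards [hmove, hp'] with ξ hξ hξ'
  obtain ⟨v, hv, hTv⟩ := exists_fixedPoint_closedBall (T := T ξ) hδ.le (half_pos hq)
    (by linarith) (fun v hv v' hv' => by
      have h1 := hlip _ (hpp (hball hv) hξ').1 _ (hpp (hball hv') hξ').1
      have h2 : (c' ∘L X'.prod (.snd ℝ _ _)) ((v, ξ) - (v', ξ)) = S (v - v') := by
        simp [S, hc']
      have h3 : ‖(v, ξ) - (v', ξ)‖ = ‖v - v'‖ := by simp [Prod.norm_def]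
      rw [h2, h3] at h1
      calc ‖T ξ v - T ξ v'‖ ≤ ‖(v + ρ • Φ (v, ξ)) - (v' + ρ • Φ (v', ξ))‖ :=
            norm_coneProj_sub_le _ _ _
        _ = ‖((v - v') + ρ • S (v - v')) + ρ • (Φ (v, ξ) - Φ (v', ξ) - S (v - v'))‖ := by
            congr 1; module
        _ ≤ (1 - q) * ‖v - v'‖ + ρ * (q / 2 / ρ * ‖v - v'‖) := by
            refine (norm_add_le _ _).trans (add_le_add (hρS _) ?_)
            rw [norm_smul, Real.norm_eq_abs, abs_of_pos hρ]
            gcongr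
        _ = (1 - q / 2) * ‖v - v'‖ := by field_simp; ring) hξ
  obtain ⟨-, h2, h3⟩ := hpp (hball hv) hξ'
  exact ⟨X (v, ξ), v, h2, hfix ξ v hTv h3⟩

end ReducedKKT

/-! ### Gradients, Hessians and a second-order sufficient condition -/

section Calculus

variable {E : Type*} [NormedAddCommGroup E] [InnerProductSpace ℝ E] [CompleteSpace E]

/-- The Hessian represents the second derivative. -/
lemma inner_fderiv_gradient {F : E → ℝ} {x : E} (y z : E) :
    inner ℝ (fderiv ℝ (gradient F) x y) z = fderiv ℝ (fderiv ℝ F) x y z := by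
  have h : gradient F = (InnerProductSpace.toDual ℝ E).symm.toContinuousLinearEquiv ∘
      fderiv ℝ F := rfl
  rw [h, ContinuousLinearEquiv.comp_fderiv]
  exact InnerProductSpace.toDual_symm_apply

lemma inner_fderiv_gradient_comm {F : E → ℝ} {x : E} (hF : ContDiffAt ℝ 2 F x) (y z : E) :
    inner ℝ (fderiv ℝ (gradient F) x y) z = inner ℝ y (fderiv ℝ (gradient F) x z) := by
  have hs : IsSymmSndFDerivAt ℝ F x := hF.isSymmSndFDerivAt (by simp)
  rw [inner_fderiv_gradient, hs y z, ← inner_fderiv_gradient, real_inner_comm]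

lemma contDiffAt_gradient {F : E → ℝ} {x : E} (hF : ContDiffAt ℝ 2 F x) :
    ContDiffAt ℝ 1 (gradient F) x :=
  (InnerProductSpace.toDual ℝ E).symm.toContinuousLinearEquiv.contDiff.contDiffAt.comp x
    (hF.fderiv_right (m := 1) (by norm_num))

/-- Second-order sufficient condition for an unconstrained local minimum. -/
lemma isLocalMin_of_gradient_eq_zero {F : E → ℝ} {x : E} (hF : ContDiffAt ℝ 2 F x)
    (h0 : gradient F x = 0) {a : ℝ} (ha : 0 < a)
    (hpos : ∀ y, a * ‖y‖ ^ 2 ≤ inner ℝ y (fderiv ℝ (gradient F) x y)) : IsLocalMin F x := by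
  have hstrict := ((contDiffAt_gradient hF).hasStrictFDerivAt (by norm_num)).hasFDerivAt
  -- The remainder ‖∇F(y) - H (y - x)‖ ≤ a ‖y - x‖ is offset by coercivity of the Hessian H, so the
  -- gradient points away from x. The mean value theorem then gives F x ≤ F y.
  have hgrad : ∀ᶠ y in 𝓝 x, 0 ≤ inner ℝ (gradient F y) (y - x) := by
    filter_upwards [hstrict.isLittleO.def ha] with y hy
    rw [h0, sub_zero] at hy
    have h1 := hpos (y - x)
    have h2 := real_inner_le_norm (-(gradient F y - fderiv ℝ (gradient F) x (y - x))) (y - x)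
    rw [norm_neg, inner_neg_left, inner_sub_left] at h2
    rw [real_inner_comm] at h1
    nlinarith [norm_nonneg (y - x)]
  have hdiff : ∀ᶠ y in 𝓝 x, DifferentiableAt ℝ F y := by
    filter_upwards [hF.eventually (by simp)] with y hy
    exact hy.differentiableAt (by norm_num)
  obtain ⟨δ, hδ, hball⟩ := Metric.eventually_nhds_iff_ball.1 (hgrad.and hdiff)
  filter_upwards [Metric.ball_mem_nhds x hδ] with y hy
  obtain ⟨z, hz, hzy⟩ := domain_mvt (f := F) (f' := fun z => fderiv ℝ F z)
    (fun z hz => (hball z hz).2.hasFDerivAt.hasFDerivWithinAt) (convex_ball x δ)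
    (Metric.mem_ball_self hδ) hy
  have hzball := (convex_ball x δ).segment_subset (Metric.mem_ball_self hδ) hy hz
  rw [segment_eq_image'] at hz
  obtain ⟨t, ⟨ht0, -⟩, rfl⟩ := hz
  have h1 := (hball _ hzball).1
  have h2 : fderiv ℝ F (x + t • (y - x)) (y - x) =
      inner ℝ (gradient F (x + t • (y - x))) (y - x) := by
    rw [gradient, InnerProductSpace.toDual_symm_apply]
  rw [h2] at hzy
  rw [add_sub_cancel_left, inner_smul_right] at h1
  have h3 : 0 ≤ inner ℝ (gradient F (x + t • (y - x))) (y - x) := by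
    rcases ht0.eq_or_lt with rfl | ht
    · simp [h0]
    · exact nonneg_of_mul_nonneg_right h1 ht
  linarith

variable {Z : Type*} [NormedAddCommGroup Z] [NormedSpace ℝ Z]

/-- The partial gradient of a `C²` function is `C¹` in all variables. -/
lemma contDiffAt_partial_gradient {F : Z × E → ℝ} {z : Z × E} (hF : ContDiffAt ℝ 2 F z) :
    ContDiffAt ℝ 1 (fun z : Z × E => gradient (fun y => F (z.1, y)) z.2) z := by
  have h1 : ContDiffAt ℝ 1 (fun z : Z × E =>
      (InnerProductSpace.toDual ℝ E).symm (fderiv ℝ F z ∘L .inr ℝ Z E)) z := by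
    refine (InnerProductSpace.toDual ℝ E).symm.toContinuousLinearEquiv.contDiff.contDiffAt.comp z ?_
    exact (hF.fderiv_right (m := 1) (by norm_num)).clm_comp contDiffAt_const
  refine h1.congr_of_eventuallyEq ?_
  filter_upwards [hF.eventually (by simp)] with w hw
  have h2 : HasFDerivAt F (fderiv ℝ F w) (w.1, w.2) :=
    (hw.differentiableAt (by norm_num)).hasFDerivAt
  have h3 : HasFDerivAt (fun y => F (w.1, y)) (fderiv ℝ F w ∘L .inr ℝ Z E) w.2 :=
    h2.comp w.2 (hasFDerivAt_prodMk_right w.1 w.2)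
  rw [gradient, h3.fderiv]

end Calculus

/-! ### Stacked multipliers and the derivatives of the reduced system -/

namespace ParamNLP

variable {n p m r : ℕ} (P : ParamNLP n p m r)

/-- The multipliers of the equality constraints and of the inequality constraints in `S`. -/
noncomputable def pack (S : Finset (Fin m)) (l : EuclideanSpace ℝ (Fin p))
    (u : EuclideanSpace ℝ (Fin m)) : EuclideanSpace ℝ (Fin p ⊕ S) :=
  WithLp.toLp 2 (Sum.elim (fun j => l j) (fun i => u i))

/-- The equality part of a stacked multiplier. -/
noncomputable def eqPart {S : Finset (Fin m)} (v : EuclideanSpace ℝ (Fin p ⊕ S)) :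
    EuclideanSpace ℝ (Fin p) :=
  WithLp.toLp 2 fun j => v (Sum.inl j)

/-- The inequality part of a stacked multiplier, extended by zero. -/
noncomputable def ineqPart {S : Finset (Fin m)} (v : EuclideanSpace ℝ (Fin p ⊕ S)) :
    EuclideanSpace ℝ (Fin m) :=
  WithLp.toLp 2 fun i => if hi : i ∈ S then v (Sum.inr ⟨i, hi⟩) else 0

section Multipliers

variable {S : Finset (Fin m)}

lemma eqPart_pack (l : EuclideanSpace ℝ (Fin p)) (u : EuclideanSpace ℝ (Fin m)) :
    eqPart (pack S l u) = l := rfl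

lemma ineqPart_pack {l : EuclideanSpace ℝ (Fin p)} {u : EuclideanSpace ℝ (Fin m)}
    (hu : ∀ i ∉ S, u i = 0) : ineqPart (pack S l u) = u := by
  ext i
  by_cases hi : i ∈ S
  · simp [ineqPart, pack, hi]
  · simp [ineqPart, hi, hu i hi]

lemma continuous_pack : Continuous fun w : EuclideanSpace ℝ (Fin p) × EuclideanSpace ℝ (Fin m) =>
    pack S w.1 w.2 := by
  refine (PiLp.continuous_toLp 2 _).comp (continuous_pi ?_)
  rintro (j | i)
  · simp only [Sum.elim_inl]; fun_prop
  · simp only [Sum.elim_inr]; fun_prop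

lemma continuous_eqPart : Continuous (eqPart : EuclideanSpace ℝ (Fin p ⊕ S) → _) :=
  (PiLp.continuous_toLp 2 _).comp (continuous_pi fun j => by fun_prop)

lemma continuous_ineqPart : Continuous (ineqPart : EuclideanSpace ℝ (Fin p ⊕ S) → _) := by
  refine (PiLp.continuous_toLp 2 _).comp (continuous_pi fun i => ?_)
  by_cases hi : i ∈ S
  · simp only [hi, dif_pos]; fun_prop
  · simp only [hi, dif_neg, not_false_eq_true]; fun_prop

/-- Multipliers outside S contribute nothing, so estimates for stacked multipliers transfer to (λ,
μ) without loss in the constant. -/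
lemma norm_sub_eq_norm_pack_sub {l l' : EuclideanSpace ℝ (Fin p)} {u u' : EuclideanSpace ℝ (Fin m)}
    (hu : ∀ i ∉ S, u i = 0) (hu' : ∀ i ∉ S, u' i = 0) :
    ‖WithLp.toLp 2 (l, u) - WithLp.toLp 2 (l', u')‖ = ‖pack S l u - pack S l' u'‖ := by
  rw [← sq_eq_sq₀ (norm_nonneg _) (norm_nonneg _), WithLp.prod_norm_sq_eq_of_L2,
    EuclideanSpace.norm_sq_eq, EuclideanSpace.norm_sq_eq, EuclideanSpace.norm_sq_eq,
    Fintype.sum_sum_type]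
  congr 1
  rw [← Finset.sum_subset (Finset.subset_univ S), ← Finset.sum_coe_sort]
  · rfl
  · intro i _ hi
    simp [hu i hi, hu' i hi]

lemma lagrangian_parts (x : EuclideanSpace ℝ (Fin n)) (v : EuclideanSpace ℝ (Fin p ⊕ S))
    (ξ : EuclideanSpace ℝ (Fin r)) :
    P.lagrangian x (eqPart v) (ineqPart v) ξ = P.f x ξ + inner ℝ v (P.constr S x ξ) := by
  rw [lagrangian, PiLp.inner_apply, Fintype.sum_sum_type, add_assoc]
  congr 2
  · refine Finset.sum_congr rfl fun j _ => ?_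
    simp [eqPart, constr, mul_comm]
  · rw [← Finset.sum_subset (Finset.subset_univ S), ← Finset.sum_coe_sort]
    · refine Finset.sum_congr rfl fun i _ => ?_
      simp [ineqPart, constr, mul_comm]
    · intro i _ hi
      simp [ineqPart, hi]

end Multipliers

/-- The gradient of the Lagrangian as a function of stacked multipliers, parameter and state. -/
noncomputable def redGrad (S : Finset (Fin m)) :
    (EuclideanSpace ℝ (Fin p ⊕ S) × EuclideanSpace ℝ (Fin r)) × EuclideanSpace ℝ (Fin n) →
      EuclideanSpace ℝ (Fin n) :=
  fun z => P.gradL z.2 (eqPart z.1.1) (ineqPart z.1.1) z.1.2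

/-- The stacked constraints as a function of state and parameter. -/
noncomputable def redConstr (S : Finset (Fin m)) :
    EuclideanSpace ℝ (Fin n) × EuclideanSpace ℝ (Fin r) → EuclideanSpace ℝ (Fin p ⊕ S) :=
  fun z => P.constr S z.1 z.2

variable {P} {Ξ : Set (EuclideanSpace ℝ (Fin r))} {S : Finset (Fin m)}
  {x : EuclideanSpace ℝ (Fin n)} {ξ : EuclideanSpace ℝ (Fin r)}

namespace IsC2On

lemma univ_prod_mem_nhds (hξ : ξ ∈ interior Ξ) :
    (univ ×ˢ Ξ : Set (EuclideanSpace ℝ (Fin n) × EuclideanSpace ℝ (Fin r))) ∈ 𝓝 (x, ξ) :=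
  prod_mem_nhds univ_mem (mem_interior_iff_mem_nhds.1 hξ)

lemma contDiffAt_f (hC2 : P.IsC2On Ξ) (hξ : ξ ∈ interior Ξ) :
    ContDiffAt ℝ 2 (fun z : EuclideanSpace ℝ (Fin n) × EuclideanSpace ℝ (Fin r) =>
      P.f z.1 z.2) (x, ξ) :=
  hC2.f.contDiffAt (univ_prod_mem_nhds hξ)

lemma contDiffAt_h (hC2 : P.IsC2On Ξ) (hξ : ξ ∈ interior Ξ) :
    ContDiffAt ℝ 2 (fun z : EuclideanSpace ℝ (Fin n) × EuclideanSpace ℝ (Fin r) =>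
      P.h z.1 z.2) (x, ξ) :=
  hC2.h.contDiffAt (univ_prod_mem_nhds hξ)

lemma contDiffAt_g (hC2 : P.IsC2On Ξ) (hξ : ξ ∈ interior Ξ) :
    ContDiffAt ℝ 2 (fun z : EuclideanSpace ℝ (Fin n) × EuclideanSpace ℝ (Fin r) =>
      P.g z.1 z.2) (x, ξ) :=
  hC2.g.contDiffAt (univ_prod_mem_nhds hξ)

lemma contDiffAt_redConstr (hC2 : P.IsC2On Ξ) (hξ : ξ ∈ interior Ξ) :
    ContDiffAt ℝ 2 (P.redConstr S) (x, ξ) := by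
  rw [contDiffAt_euclidean]
  rintro (j | i)
  · exact contDiffAt_euclidean.1 (hC2.contDiffAt_h hξ) j
  · exact contDiffAt_euclidean.1 (hC2.contDiffAt_g hξ) i

lemma contDiffAt_redLagrangian (hC2 : P.IsC2On Ξ) (hξ : ξ ∈ interior Ξ)
    (v : EuclideanSpace ℝ (Fin p ⊕ S)) :
    ContDiffAt ℝ 2 (fun z : (EuclideanSpace ℝ (Fin p ⊕ S) × EuclideanSpace ℝ (Fin r)) ×
      EuclideanSpace ℝ (Fin n) => P.lagrangian z.2 (eqPart z.1.1) (ineqPart z.1.1) z.1.2)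
      ((v, ξ), x) := by
  simp only [lagrangian_parts]
  have hproj : ContDiffAt ℝ 2 (fun z : (EuclideanSpace ℝ (Fin p ⊕ S) × EuclideanSpace ℝ (Fin r)) ×
      EuclideanSpace ℝ (Fin n) => (z.2, z.1.2)) ((v, ξ), x) := by fun_prop
  refine ContDiffAt.add ?_ (ContDiffAt.inner ℝ (by fun_prop) ?_)
  · exact ContDiffAt.comp (g := fun z : EuclideanSpace ℝ (Fin n) × EuclideanSpace ℝ (Fin r) =>
      P.f z.1 z.2) ((v, ξ), x) (hC2.contDiffAt_f hξ) hproj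
  · exact ContDiffAt.comp (g := P.redConstr S) ((v, ξ), x) (hC2.contDiffAt_redConstr hξ) hproj

lemma contDiffAt_lagrangian (hC2 : P.IsC2On Ξ) (hξ : ξ ∈ interior Ξ)
    (v : EuclideanSpace ℝ (Fin p ⊕ S)) :
    ContDiffAt ℝ 2 (fun y => P.lagrangian y (eqPart v) (ineqPart v) ξ) x :=
  ContDiffAt.comp (f := fun y => ((v, ξ), y)) x (hC2.contDiffAt_redLagrangian hξ v) (by fun_prop)

lemma contDiffAt_redGrad (hC2 : P.IsC2On Ξ) (hξ : ξ ∈ interior Ξ)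
    (v : EuclideanSpace ℝ (Fin p ⊕ S)) : ContDiffAt ℝ 1 (P.redGrad S) ((v, ξ), x) :=
  contDiffAt_partial_gradient (hC2.contDiffAt_redLagrangian hξ v)

lemma hasStrictFDerivAt_redGrad (hC2 : P.IsC2On Ξ) (hξ : ξ ∈ interior Ξ)
    (v : EuclideanSpace ℝ (Fin p ⊕ S)) :
    HasStrictFDerivAt (P.redGrad S) (fderiv ℝ (P.redGrad S) ((v, ξ), x)) ((v, ξ), x) :=
  (hC2.contDiffAt_redGrad hξ v).hasStrictFDerivAt (by norm_num)

lemma hasStrictFDerivAt_redConstr (hC2 : P.IsC2On Ξ) (hξ : ξ ∈ interior Ξ) :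
    HasStrictFDerivAt (P.redConstr S) (fderiv ℝ (P.redConstr S) (x, ξ)) (x, ξ) :=
  (hC2.contDiffAt_redConstr hξ).hasStrictFDerivAt (by norm_num)

lemma hessL_eq (hC2 : P.IsC2On Ξ) (hξ : ξ ∈ interior Ξ) (v : EuclideanSpace ℝ (Fin p ⊕ S)) :
    P.hessL x (eqPart v) (ineqPart v) ξ =
      fderiv ℝ (P.redGrad S) ((v, ξ), x) ∘L .inr ℝ _ _ :=
  ((hC2.hasStrictFDerivAt_redGrad hξ v).hasFDerivAt.comp x
    (hasFDerivAt_prodMk_right (v, ξ) x)).fderiv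

lemma mixedL_eq (hC2 : P.IsC2On Ξ) (hξ : ξ ∈ interior Ξ) (v : EuclideanSpace ℝ (Fin p ⊕ S)) :
    P.mixedL x (eqPart v) (ineqPart v) ξ =
      fderiv ℝ (P.redGrad S) ((v, ξ), x) ∘L .inl ℝ _ _ ∘L .inr ℝ _ _ :=
  (HasFDerivAt.comp (g := P.redGrad S) (f := fun ζ => ((v, ζ), x)) ξ
    (hC2.hasStrictFDerivAt_redGrad hξ v).hasFDerivAt
    (HasFDerivAt.comp (g := fun z => (z, x)) (f := fun ζ => (v, ζ)) ξ
      (hasFDerivAt_prodMk_left (v, ξ) x) (hasFDerivAt_prodMk_right v ξ))).fderiv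

lemma hasFDerivAt_constr (hC2 : P.IsC2On Ξ) (hξ : ξ ∈ interior Ξ) :
    HasFDerivAt (fun y => P.constr S y ξ)
      (fderiv ℝ (P.redConstr S) (x, ξ) ∘L .inl ℝ _ _) x :=
  HasFDerivAt.comp (g := P.redConstr S) (f := fun y => (y, ξ)) x
    (hC2.hasStrictFDerivAt_redConstr hξ).hasFDerivAt (hasFDerivAt_prodMk_left x ξ)

lemma hasFDerivAt_constr_param (hC2 : P.IsC2On Ξ) (hξ : ξ ∈ interior Ξ) :
    HasFDerivAt (fun ζ => P.constr S x ζ)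
      (fderiv ℝ (P.redConstr S) (x, ξ) ∘L .inr ℝ _ _) ξ :=
  (hC2.hasStrictFDerivAt_redConstr hξ).hasFDerivAt.comp ξ (hasFDerivAt_prodMk_right x ξ)

/-- The gradient of the Lagrangian is affine in the multipliers. -/
lemma redGrad_eq (hC2 : P.IsC2On Ξ) (hξ : ξ ∈ interior Ξ) (v : EuclideanSpace ℝ (Fin p ⊕ S)) :
    P.redGrad S ((v, ξ), x) = gradient (fun y => P.f y ξ) x +
      ContinuousLinearMap.adjoint (fderiv ℝ (fun y => P.constr S y ξ) x) v := by
  have hf : HasFDerivAt (fun y => P.f y ξ) (fderiv ℝ (fun y => P.f y ξ) x) x := by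
    refine DifferentiableAt.hasFDerivAt ?_
    exact DifferentiableAt.comp (f := fun y => (y, ξ)) x
      ((hC2.contDiffAt_f hξ).differentiableAt (by norm_num)) (by fun_prop)
  have hc : HasFDerivAt (fun y => P.constr S y ξ) (fderiv ℝ (fun y => P.constr S y ξ) x) x :=
    (hC2.hasFDerivAt_constr hξ).differentiableAt.hasFDerivAt
  have h1 := hf.add ((hasFDerivAt_const v x).inner ℝ hc)
  have h2 : P.redGrad S ((v, ξ), x) =
      gradient (fun y => P.f y ξ + inner ℝ v (P.constr S y ξ)) x := by
    simp only [redGrad, gradL, lagrangian_parts]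
  rw [h2]
  refine HasGradientAt.gradient (hasGradientAt_iff_hasFDerivAt.2 ?_)
  convert! h1 using 1
  ext y
  simp [ContinuousLinearMap.adjoint_inner_left, gradient]

/-- The multiplier direction gives the transposed constraint Jacobian because the gradient is affine
in v; together with `fderiv_redConstr_apply` this is the saddle point structure behind the linear
estimates. -/
lemma fderiv_redGrad_apply (hC2 : P.IsC2On Ξ) (hξ : ξ ∈ interior Ξ)
    (v w : EuclideanSpace ℝ (Fin p ⊕ S)) (d : EuclideanSpace ℝ (Fin r))
    (y : EuclideanSpace ℝ (Fin n)) :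
    fderiv ℝ (P.redGrad S) ((v, ξ), x) ((w, d), y) =
      P.hessL x (eqPart v) (ineqPart v) ξ y +
        ContinuousLinearMap.adjoint (fderiv ℝ (fun y => P.constr S y ξ) x) w +
        P.mixedL x (eqPart v) (ineqPart v) ξ d := by
  have h1 : HasFDerivAt (fun v => P.redGrad S ((v, ξ), x))
      (fderiv ℝ (P.redGrad S) ((v, ξ), x) ∘L .inl ℝ _ _ ∘L .inl ℝ _ _) v :=
    HasFDerivAt.comp (g := P.redGrad S) (f := fun v => ((v, ξ), x)) v
      (hC2.hasStrictFDerivAt_redGrad hξ v).hasFDerivAt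
      (HasFDerivAt.comp (g := fun z => (z, x)) (f := fun v => (v, ξ)) v
        (hasFDerivAt_prodMk_left (v, ξ) x) (hasFDerivAt_prodMk_left v ξ))
  have h2 : HasFDerivAt (fun v => P.redGrad S ((v, ξ), x))
      (ContinuousLinearMap.adjoint (fderiv ℝ (fun y => P.constr S y ξ) x)) v := by
    simp only [hC2.redGrad_eq hξ]
    exact (ContinuousLinearMap.hasFDerivAt _).const_add _
  rw [← h1.unique h2, hC2.hessL_eq hξ, hC2.mixedL_eq hξ]
  simp only [ContinuousLinearMap.comp_apply, ContinuousLinearMap.inl_apply,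
    ContinuousLinearMap.inr_apply, ← map_add, Prod.mk_add_mk]
  simp

lemma fderiv_redConstr_apply (hC2 : P.IsC2On Ξ) (hξ : ξ ∈ interior Ξ)
    (y : EuclideanSpace ℝ (Fin n)) (d : EuclideanSpace ℝ (Fin r)) :
    fderiv ℝ (P.redConstr S) (x, ξ) (y, d) =
      fderiv ℝ (fun y => P.constr S y ξ) x y + fderiv ℝ (fun ζ => P.constr S x ζ) ξ d := by
  rw [(hC2.hasFDerivAt_constr hξ).fderiv, (hC2.hasFDerivAt_constr_param hξ).fderiv]
  simp only [ContinuousLinearMap.comp_apply, ContinuousLinearMap.inl_apply,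
    ContinuousLinearMap.inr_apply, ← map_add, Prod.mk_add_mk]
  simp

lemma hessL_symm (hC2 : P.IsC2On Ξ) (hξ : ξ ∈ interior Ξ) (v : EuclideanSpace ℝ (Fin p ⊕ S))
    (y z : EuclideanSpace ℝ (Fin n)) :
    inner ℝ (P.hessL x (eqPart v) (ineqPart v) ξ y) z =
      inner ℝ y (P.hessL x (eqPart v) (ineqPart v) ξ z) :=
  inner_fderiv_gradient_comm (hC2.contDiffAt_lagrangian hξ v) y z

lemma gradient_constr_apply (hC2 : P.IsC2On Ξ) (hξ : ξ ∈ interior Ξ) (k : Fin p ⊕ S) :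
    gradient (fun y => P.constr S y ξ k) x =
      ContinuousLinearMap.adjoint (fderiv ℝ (fun y => P.constr S y ξ) x)
        (EuclideanSpace.single k 1) := by
  have hc : HasFDerivAt (fun y => P.constr S y ξ) (fderiv ℝ (fun y => P.constr S y ξ) x) x :=
    (hC2.hasFDerivAt_constr hξ).differentiableAt.hasFDerivAt
  refine HasGradientAt.gradient (hasGradientAt_iff_hasFDerivAt.2 ?_)
  have h1 : HasFDerivAt (fun y => P.constr S y ξ k)
      (EuclideanSpace.proj k ∘L fderiv ℝ (fun y => P.constr S y ξ) x) x :=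
    (EuclideanSpace.proj k : EuclideanSpace ℝ (Fin p ⊕ S) →L[ℝ] ℝ).hasFDerivAt.comp x hc
  convert! h1 using 1
  ext y
  rw [InnerProductSpace.toDual_apply_apply, ContinuousLinearMap.adjoint_inner_left]
  exact (EuclideanSpace.inner_single_left k 1 _).trans (by simp)

lemma linearIndependent_gradient_iff (hC2 : P.IsC2On Ξ) (hξ : ξ ∈ interior Ξ) :
    LinearIndependent ℝ (fun k : Fin p ⊕ S => gradient (fun y => P.constr S y ξ k) x) ↔
      Function.Injective
        (ContinuousLinearMap.adjoint (fderiv ℝ (fun y => P.constr S y ξ) x)) := by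
  simp only [hC2.gradient_constr_apply hξ]
  set T := ContinuousLinearMap.adjoint (fderiv ℝ (fun y => P.constr S y ξ) x)
  have hT : ∀ v : EuclideanSpace ℝ (Fin p ⊕ S),
      T v = ∑ k, v k • T (EuclideanSpace.single k 1) := by
    intro v
    conv_lhs => rw [← (EuclideanSpace.basisFun (Fin p ⊕ S) ℝ).sum_repr v]
    simp
  rw [Fintype.linearIndependent_iff]
  constructor
  · intro h
    rw [injective_iff_map_eq_zero]
    intro v hv
    ext k
    exact h (fun k => v k) (by rw [← hT, hv]) k
  · intro h g hg k
    have : T (WithLp.toLp 2 g) = 0 := by rw [hT]; exact hg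
    have := (injective_iff_map_eq_zero T).1 h _ this
    exact congrFun (congrArg WithLp.ofLp this) k

end IsC2On

end ParamNLP

/-! ### KKT points versus the reduced system, and openness of the regularity conditions -/

namespace ParamNLP

variable {n p m r : ℕ} {P : ParamNLP n p m r} {Ξ : Set (EuclideanSpace ℝ (Fin r))}
  {S : Finset (Fin m)} {x : EuclideanSpace ℝ (Fin n)} {l : EuclideanSpace ℝ (Fin p)}
  {u : EuclideanSpace ℝ (Fin m)} {v : EuclideanSpace ℝ (Fin p ⊕ S)}
  {ξ : EuclideanSpace ℝ (Fin r)}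

lemma mem_active_iff {i : Fin m} : i ∈ P.active x ξ ↔ P.g x ξ i = 0 := by
  simp [active]

lemma KKT.mul_eq_zero (h : P.KKT x l u ξ) (i : Fin m) : u i * P.g x ξ i = 0 := by
  rcases (h.mem_feasible.2 i).lt_or_eq with hi | hi
  · rw [h.compl i hi, zero_mul]
  · rw [hi, mul_zero]

lemma KKT.apply_eq_zero (h : P.KKT x l u ξ) (hS : ∀ i ∉ S, P.g x ξ i < 0) (i : Fin m)
    (hi : i ∉ S) : u i = 0 :=
  h.compl i (hS i hi)

lemma KKT.reducedKKT (h : P.KKT x l u ξ) (hS : ∀ i ∉ S, P.g x ξ i < 0) :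
    ReducedKKT (range Sum.inr) (P.redGrad S) (P.redConstr S) x (pack S l u) ξ where
  stationary := by
    simp only [redGrad, eqPart_pack, ineqPart_pack (h.apply_eq_zero hS)]
    exact h.stationary
  eq_zero := by
    rintro (j | i) hk
    · exact congrFun (congrArg WithLp.ofLp h.mem_feasible.1) j
    · exact absurd ⟨i, rfl⟩ hk
  nonpos := by
    rintro _ ⟨i, rfl⟩
    exact h.mem_feasible.2 i
  nonneg := by
    rintro _ ⟨i, rfl⟩
    exact h.nonneg i
  compl := by
    rintro _ ⟨i, rfl⟩
    exact h.mul_eq_zero i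

lemma _root_.ReducedKKT.kkt
    (h : ReducedKKT (range Sum.inr) (P.redGrad S) (P.redConstr S) x v ξ)
    (hS : ∀ i ∉ S, P.g x ξ i < 0) : P.KKT x (eqPart v) (ineqPart v) ξ where
  mem_feasible := by
    refine ⟨?_, fun i => ?_⟩
    · ext j
      exact h.eq_zero (Sum.inl j) (by simp)
    · by_cases hi : i ∈ S
      · exact h.nonpos (Sum.inr ⟨i, hi⟩) ⟨_, rfl⟩
      · exact (hS i hi).le
  nonneg := by
    intro i
    by_cases hi : i ∈ S
    · simpa [ineqPart, hi] using h.nonneg (Sum.inr ⟨i, hi⟩) ⟨_, rfl⟩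
    · simp [ineqPart, hi]
  stationary := h.stationary
  compl := by
    intro i hgi
    by_cases hi : i ∈ S
    · have h1 := h.compl (Sum.inr ⟨i, hi⟩) ⟨_, rfl⟩
      simpa [ineqPart, hi] using (_root_.mul_eq_zero.1 h1).resolve_right hgi.ne
    · simp [ineqPart, hi]

/-- A KKT point at which the Lagrangian has a local minimum is a local minimizer. -/
lemma KKT.isLocalMinOn (h : P.KKT x l u ξ) (hL : IsLocalMin (fun y => P.lagrangian y l u ξ) x) :
    IsLocalMinOn (fun y => P.f y ξ) (P.feasible ξ) x := by
  -- On the feasible set the Lagrangian lies below f because u ≥ 0 ≥ g, and at x the two agree by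
  -- complementarity.
  have hle : ∀ y ∈ P.feasible ξ, P.lagrangian y l u ξ ≤ P.f y ξ := by
    intro y hy
    have h1 : ∑ i, u i * P.g y ξ i ≤ 0 :=
      Finset.sum_nonpos fun i _ => mul_nonpos_of_nonneg_of_nonpos (h.nonneg i) (hy.2 i)
    simp only [lagrangian, hy.1, PiLp.zero_apply, mul_zero, Finset.sum_const_zero, add_zero]
    linarith
  have heq : P.lagrangian x l u ξ = P.f x ξ := by
    simp [lagrangian, h.mem_feasible.1, h.mul_eq_zero]
  filter_upwards [hL.filter_mono nhdsWithin_le_nhds, self_mem_nhdsWithin] with y hy hyf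
  rw [← heq]
  exact hy.trans (hle y hyf)

namespace IsC2On

lemma eventually_inactive (hC2 : P.IsC2On Ξ) (hξ : ξ ∈ interior Ξ)
    (hS : ∀ i ∉ S, P.g x ξ i < 0) :
    ∀ᶠ z : EuclideanSpace ℝ (Fin n) × EuclideanSpace ℝ (Fin r) in 𝓝 (x, ξ),
      ∀ i ∉ S, P.g z.1 z.2 i < 0 := by
  rw [eventually_all]
  intro i
  by_cases hi : i ∈ S
  · exact Eventually.of_forall fun z h => absurd hi h
  · have hc : ContinuousAt (fun z : EuclideanSpace ℝ (Fin n) × EuclideanSpace ℝ (Fin r) =>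
        P.g z.1 z.2 i) (x, ξ) :=
      (contDiffAt_euclidean.1 (hC2.contDiffAt_g hξ) i).continuousAt
    filter_upwards [hc.eventually_lt_const (hS i hi)] with z hz _ using hz

lemma eventually_hessL_coercive (hC2 : P.IsC2On Ξ) (hξ : ξ ∈ interior Ξ) {a : ℝ} (ha : 0 < a)
    (hA : ∀ y, a * ‖y‖ ^ 2 ≤ inner ℝ y (P.hessL x (eqPart v) (ineqPart v) ξ y)) :
    ∀ᶠ z : (EuclideanSpace ℝ (Fin p ⊕ S) × EuclideanSpace ℝ (Fin r)) × EuclideanSpace ℝ (Fin n)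
      in 𝓝 ((v, ξ), x), ∀ y, a / 2 * ‖y‖ ^ 2 ≤
        inner ℝ y (P.hessL z.2 (eqPart z.1.1) (ineqPart z.1.1) z.1.2 y) := by
  have hcont : ContinuousAt (fderiv ℝ (P.redGrad S)) ((v, ξ), x) :=
    ((hC2.contDiffAt_redGrad hξ v).fderiv_right (m := 0) (by norm_num)).continuousAt
  have hcont' : ContinuousAt (fun z => fderiv ℝ (P.redGrad S) z ∘L
      .inr ℝ (EuclideanSpace ℝ (Fin p ⊕ S) × EuclideanSpace ℝ (Fin r)) (EuclideanSpace ℝ (Fin n)))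
      ((v, ξ), x) :=
    hcont.clm_comp continuousAt_const
  have hΞ : ∀ᶠ z : (EuclideanSpace ℝ (Fin p ⊕ S) × EuclideanSpace ℝ (Fin r)) ×
      EuclideanSpace ℝ (Fin n) in 𝓝 ((v, ξ), x), z.1.2 ∈ interior Ξ := by
    have : ContinuousAt (fun z : (EuclideanSpace ℝ (Fin p ⊕ S) × EuclideanSpace ℝ (Fin r)) ×
      EuclideanSpace ℝ (Fin n) => z.1.2) ((v, ξ), x) := by fun_prop
    exact this (isOpen_interior.mem_nhds hξ)
  filter_upwards [hcont'.eventually (Metric.closedBall_mem_nhds _ (half_pos ha)), hΞ]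
    with ⟨⟨w, ζ⟩, z⟩ hz hzξ y
  rw [hC2.hessL_eq hξ] at hA
  rw [hC2.hessL_eq hzξ]
  rw [dist_comm, dist_eq_norm] at hz
  have h1 := hA y
  have h2 := real_inner_le_norm y ((fderiv ℝ (P.redGrad S) ((v, ξ), x) ∘L .inr ℝ _ _ -
    fderiv ℝ (P.redGrad S) ((w, ζ), z) ∘L .inr ℝ _ _) y)
  have h3 : ‖y‖ * ‖(fderiv ℝ (P.redGrad S) ((v, ξ), x) ∘L .inr ℝ _ _ -
      fderiv ℝ (P.redGrad S) ((w, ζ), z) ∘L .inr ℝ _ _) y‖ ≤ ‖y‖ * (a / 2 * ‖y‖) := by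
    gcongr
    exact ContinuousLinearMap.le_of_opNorm_le _ hz y
  have h4 := h2.trans h3
  rw [sub_apply, inner_sub_right] at h4
  linarith

lemma eventually_adjoint_injective (hC2 : P.IsC2On Ξ) (hξ : ξ ∈ interior Ξ) {σ : ℝ} (hσ : 0 < σ)
    (hB : ∀ v, σ * ‖v‖ ≤
      ‖ContinuousLinearMap.adjoint (fderiv ℝ (fun y => P.constr S y ξ) x) v‖) :
    ∀ᶠ z : EuclideanSpace ℝ (Fin n) × EuclideanSpace ℝ (Fin r) in 𝓝 (x, ξ),
      Function.Injective (ContinuousLinearMap.adjoint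
        (fderiv ℝ (fun y => P.constr S y z.2) z.1)) := by
  have hcont : ContinuousAt (fderiv ℝ (P.redConstr S)) (x, ξ) :=
    ((hC2.contDiffAt_redConstr hξ).fderiv_right (m := 0) (by norm_num)).continuousAt
  have hcont' : ContinuousAt (fun z => ContinuousLinearMap.adjoint (fderiv ℝ (P.redConstr S) z ∘L
      .inl ℝ (EuclideanSpace ℝ (Fin n)) (EuclideanSpace ℝ (Fin r)))) (x, ξ) :=
    ContinuousLinearMap.adjoint.continuous.continuousAt.comp (hcont.clm_comp continuousAt_const)
  have hΞ : ∀ᶠ z : EuclideanSpace ℝ (Fin n) × EuclideanSpace ℝ (Fin r) in 𝓝 (x, ξ),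
      z.2 ∈ interior Ξ :=
    continuousAt_snd (isOpen_interior.mem_nhds hξ)
  filter_upwards [hcont'.eventually (Metric.ball_mem_nhds _ hσ), hΞ] with z hz hzξ
  rw [(hC2.hasFDerivAt_constr hξ).fderiv] at hB
  rw [(hC2.hasFDerivAt_constr hzξ).fderiv, injective_iff_map_eq_zero]
  intro w hw
  rw [dist_comm, dist_eq_norm] at hz
  have h1 := hB w
  have h2 := ContinuousLinearMap.le_opNorm
    (ContinuousLinearMap.adjoint (fderiv ℝ (P.redConstr S) (x, ξ) ∘L .inl ℝ _ _) -
      ContinuousLinearMap.adjoint (fderiv ℝ (P.redConstr S) z ∘L .inl ℝ _ _)) w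
  rw [sub_apply, hw, sub_zero] at h2
  by_contra hne
  have h3 : 0 < ‖w‖ := norm_pos_iff.2 hne
  nlinarith

/-- Constraints active at the new point already lie in S, so their gradients are a subfamily of a
linearly independent family. The active set may shrink, which is why injectivity is tracked for the
fixed S. -/
lemma licq_of_injective (hC2 : P.IsC2On Ξ) (hξ : ξ ∈ interior Ξ)
    (hS : ∀ i ∉ S, P.g x ξ i < 0)
    (hinj : Function.Injective (ContinuousLinearMap.adjoint
        (fderiv ℝ (fun y => P.constr S y ξ) x))) : P.LICQ x ξ := by
  have hsub : ∀ i : P.active x ξ, (i : Fin m) ∈ S := fun i => by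
    by_contra hi
    exact (hS i hi).ne (mem_active_iff.1 i.2)
  let φ : Fin p ⊕ P.active x ξ → Fin p ⊕ S := Sum.map id fun i => ⟨i, hsub i⟩
  have hφ : Function.Injective φ :=
    Function.injective_id.sumMap fun i j hij => Subtype.ext (congrArg (fun k : S => (k : Fin m)) hij)
  have h1 := ((hC2.linearIndependent_gradient_iff hξ).2 hinj).comp φ hφ
  have h2 : (fun k : Fin p ⊕ P.active x ξ =>
      gradient (fun y => P.constr (P.active x ξ) y ξ k) x) =
      (fun k : Fin p ⊕ S => gradient (fun y => P.constr S y ξ k) x) ∘ φ := by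
    funext k
    rcases k with j | i <;> rfl
  rw [LICQ, h2]
  exact h1

end IsC2On

end ParamNLP

/-! ### Existence of solution maps and their Lipschitz estimates -/

/-- With no constraints every positive σ works, so 1 stands in; only the nonempty case is tied to
`sigmaMin`. -/
lemma exists_bddBelow_of_injective {ι κ : Type*} [Fintype ι] [Fintype κ]
    {T : EuclideanSpace ℝ ι →L[ℝ] EuclideanSpace ℝ κ} (hT : Function.Injective T) :
    ∃ σ > 0, (∀ v, σ * ‖v‖ ≤ ‖T v‖) ∧ (Nonempty ι → σ = sigmaMin T) := by
  rcases isEmpty_or_nonempty ι with hι | hι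
  · exact ⟨1, one_pos, fun v => by simp [Subsingleton.elim v 0], fun h => (h.elim hι.false).elim⟩
  · exact ⟨sigmaMin T, sigmaMin_pos hT, sigmaMin_mul_norm_le hT, fun _ => rfl⟩

lemma exists_bounds_of_pos {E : Type*} [NormedAddCommGroup E] [InnerProductSpace ℝ E]
    [FiniteDimensional ℝ E] (A : E →L[ℝ] E) (hA : ∀ y, y ≠ 0 → 0 < inner ℝ y (A y)) :
    ∃ a > 0, ∃ b > 0, (∀ y, a * ‖y‖ ^ 2 ≤ inner ℝ y (A y)) ∧
      ∀ y, ‖A y‖ ^ 2 ≤ b * inner ℝ y (A y) := by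
  obtain ⟨a, ha, hmin⟩ := exists_coercive_of_pos A hA
  refine ⟨a, ha, ‖A‖ ^ 2 / a + 1, by positivity, hmin, fun y => ?_⟩
  have h0 : 0 ≤ inner ℝ y (A y) := le_trans (by positivity) (hmin y)
  calc ‖A y‖ ^ 2 ≤ (‖A‖ * ‖y‖) ^ 2 := pow_le_pow_left₀ (norm_nonneg _) (A.le_opNorm y) 2
    _ = ‖A‖ ^ 2 / a * (a * ‖y‖ ^ 2) := by field_simp
    _ ≤ ‖A‖ ^ 2 / a * inner ℝ y (A y) := by gcongr; exact hmin y
    _ ≤ _ := by linarith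

namespace ParamNLP

variable {n p m r : ℕ} {P : ParamNLP n p m r} {Ξ : Set (EuclideanSpace ℝ (Fin r))}
  {x₀ : EuclideanSpace ℝ (Fin n)} {l₀ : EuclideanSpace ℝ (Fin p)}
  {u₀ : EuclideanSpace ℝ (Fin m)} {ξ₀ : EuclideanSpace ℝ (Fin r)} {a b σ : ℝ}

lemma KKT.lt_zero_of_notMem_active (h : P.KKT x₀ l₀ u₀ ξ₀) (i : Fin m)
    (hi : i ∉ P.active x₀ ξ₀) : P.g x₀ ξ₀ i < 0 :=
  lt_of_le_of_ne (h.mem_feasible.2 i) fun h0 => hi (mem_active_iff.2 h0)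

lemma KKT.ineqPart_pack_active (h : P.KKT x₀ l₀ u₀ ξ₀) :
    ineqPart (pack (P.active x₀ ξ₀) l₀ u₀) = u₀ :=
  ineqPart_pack (h.apply_eq_zero h.lt_zero_of_notMem_active)

namespace IsC2On

lemma hessL_symm_of_kkt (hC2 : P.IsC2On Ξ) (hξ₀ : ξ₀ ∈ interior Ξ) (h : P.KKT x₀ l₀ u₀ ξ₀)
    (y z : EuclideanSpace ℝ (Fin n)) :
    inner ℝ (P.hessL x₀ l₀ u₀ ξ₀ y) z = inner ℝ y (P.hessL x₀ l₀ u₀ ξ₀ z) := by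
  have h1 := hC2.hessL_symm (x := x₀) hξ₀ (pack (P.active x₀ ξ₀) l₀ u₀) y z
  rwa [h.ineqPart_pack_active, eqPart_pack] at h1

lemma fderiv_redGrad_apply_of_kkt (hC2 : P.IsC2On Ξ) (hξ₀ : ξ₀ ∈ interior Ξ)
    (h : P.KKT x₀ l₀ u₀ ξ₀) (w : EuclideanSpace ℝ (Fin p ⊕ P.active x₀ ξ₀))
    (d : EuclideanSpace ℝ (Fin r)) (y : EuclideanSpace ℝ (Fin n)) :
    fderiv ℝ (P.redGrad (P.active x₀ ξ₀)) ((pack (P.active x₀ ξ₀) l₀ u₀, ξ₀), x₀) ((w, d), y) =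
      P.hessL x₀ l₀ u₀ ξ₀ y + ContinuousLinearMap.adjoint (P.jacX x₀ ξ₀) w +
        P.mixedL x₀ l₀ u₀ ξ₀ d := by
  have h1 := hC2.fderiv_redGrad_apply (x := x₀) hξ₀ (pack (P.active x₀ ξ₀) l₀ u₀) w d y
  rwa [h.ineqPart_pack_active, eqPart_pack] at h1

lemma adjoint_jacX_injective (hC2 : P.IsC2On Ξ) (hξ₀ : ξ₀ ∈ interior Ξ) (h : P.LICQ x₀ ξ₀) :
    Function.Injective (ContinuousLinearMap.adjoint (P.jacX x₀ ξ₀)) :=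
  (hC2.linearIndependent_gradient_iff hξ₀).1 h

/-- KKT points near a regular minimizer depend on the parameter in a Lipschitz way. -/
theorem exists_lipschitz_nhds (hC2 : P.IsC2On Ξ) (hξ₀ : ξ₀ ∈ interior Ξ)
    (hkkt : P.KKT x₀ l₀ u₀ ξ₀) (ha : 0 < a) (hb : 0 < b)
    (hmin : ∀ y, a * ‖y‖ ^ 2 ≤ inner ℝ y (P.hessL x₀ l₀ u₀ ξ₀ y))
    (hmax : ∀ y, ‖P.hessL x₀ l₀ u₀ ξ₀ y‖ ^ 2 ≤ b * inner ℝ y (P.hessL x₀ l₀ u₀ ξ₀ y))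
    (hσ : 0 < σ) (hB : ∀ v, σ * ‖v‖ ≤ ‖ContinuousLinearMap.adjoint (P.jacX x₀ ξ₀) v‖)
    {ℓ ℓ' : ℝ}
    (hℓ : ‖P.mixedL x₀ l₀ u₀ ξ₀‖ / a + √(b / a) * (‖P.jacXi x₀ ξ₀‖ / σ) < ℓ)
    (hdual : b / a * ‖P.mixedL x₀ l₀ u₀ ξ₀‖ / σ + b * ‖P.jacXi x₀ ξ₀‖ / σ ^ 2 < ℓ') :
    ∃ W ∈ 𝓝 ((pack (P.active x₀ ξ₀) l₀ u₀, ξ₀), x₀), ∀ x v ξ x' v' ξ',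
      ((v, ξ), x) ∈ W → ((v', ξ'), x') ∈ W →
      ReducedKKT (range Sum.inr) (P.redGrad _) (P.redConstr _) x v ξ →
      ReducedKKT (range Sum.inr) (P.redGrad _) (P.redConstr _) x' v' ξ' →
        ‖x - x'‖ ≤ ℓ * ‖ξ - ξ'‖ ∧ ‖v - v'‖ ≤ ℓ' * ‖ξ - ξ'‖ :=
  ReducedKKT.exists_lipschitz_nhds (hC2.hasStrictFDerivAt_redGrad hξ₀ _)
    (hC2.fderiv_redGrad_apply_of_kkt hξ₀ hkkt) (hC2.hasStrictFDerivAt_redConstr hξ₀)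
    (hC2.fderiv_redConstr_apply hξ₀) (hC2.hessL_symm_of_kkt hξ₀ hkkt) ha hb hmin hmax hσ hB hℓ hdual

/-- Existence of continuous solution maps through a regular minimizer. -/
theorem exists_isSolutionMap (hC2 : P.IsC2On Ξ) (hξ₀ : ξ₀ ∈ interior Ξ)
    (hreg : P.IsRegularMinimizer x₀ l₀ u₀ ξ₀)
    (hA : ∀ y, y ≠ 0 → 0 < inner ℝ y (P.hessL x₀ l₀ u₀ ξ₀ y)) :
    ∃ N xs ls us, P.IsSolutionMap Ξ x₀ l₀ u₀ ξ₀ N xs ls us := by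
  have hkkt := hreg.kkt
  obtain ⟨a, ha, b, hb, hmin, hmax⟩ := exists_bounds_of_pos _ hA
  obtain ⟨σ, hσ, hB, -⟩ := exists_bddBelow_of_injective (hC2.adjoint_jacX_injective hξ₀ hreg.licq)
  obtain ⟨W₁, hW₁, hlip⟩ := hC2.exists_lipschitz_nhds hξ₀ hkkt ha hb hmin hmax hσ hB
    (lt_add_one _) (lt_add_one _)
  set S := P.active x₀ ξ₀
  set v₀ := pack S l₀ u₀ with hv₀
  set ℓ := ‖P.mixedL x₀ l₀ u₀ ξ₀‖ / a + √(b / a) * (‖P.jacXi x₀ ξ₀‖ / σ) + 1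
  set ℓ' := b / a * ‖P.mixedL x₀ l₀ u₀ ξ₀‖ / σ + b * ‖P.jacXi x₀ ξ₀‖ / σ ^ 2 + 1
  have hℓ : 0 ≤ ℓ := by positivity
  have hℓ' : 0 ≤ ℓ' := by positivity
  have hl₀ : eqPart v₀ = l₀ := eqPart_pack _ _
  have hu₀ : ineqPart v₀ = u₀ := hkkt.ineqPart_pack_active
  have hpc : Tendsto (fun z : (EuclideanSpace ℝ (Fin p ⊕ S) × EuclideanSpace ℝ (Fin r)) ×
      EuclideanSpace ℝ (Fin n) => (z.2, z.1.2)) (𝓝 ((v₀, ξ₀), x₀)) (𝓝 (x₀, ξ₀)) :=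
    (by fun_prop : Continuous fun z : (EuclideanSpace ℝ (Fin p ⊕ S) ×
      EuclideanSpace ℝ (Fin r)) × EuclideanSpace ℝ (Fin n) => (z.2, z.1.2)).tendsto _
  have hcoer := hC2.eventually_hessL_coercive (x := x₀) (v := v₀) hξ₀ ha
    (by rw [hl₀, hu₀]; exact hmin)
  have hinact := hpc.eventually (hC2.eventually_inactive hξ₀ hkkt.lt_zero_of_notMem_active)
  have hinj := hpc.eventually (hC2.eventually_adjoint_injective hξ₀ hσ hB)
  have hR₀ := hkkt.reducedKKT hkkt.lt_zero_of_notMem_active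
  obtain ⟨W, hW, hWall⟩ :=
    (Filter.Eventually.and hW₁ (hcoer.and (hinact.and hinj))).exists_mem
  have hex := ReducedKKT.eventually_exists (hC2.hasStrictFDerivAt_redGrad hξ₀ _)
    (hC2.fderiv_redGrad_apply_of_kkt hξ₀ hkkt) (hC2.hasStrictFDerivAt_redConstr hξ₀)
    (hC2.fderiv_redConstr_apply hξ₀) ha hb hmin hmax hσ hB hR₀ hW
  let N : Set (EuclideanSpace ℝ (Fin r)) := {ξ | (∃ x v, ((v, ξ), x) ∈ W ∧
    ReducedKKT (range Sum.inr) (P.redGrad S) (P.redConstr S) x v ξ) ∧ ξ ∈ interior Ξ}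
  have hN : N ∈ 𝓝 ξ₀ := hex.and (isOpen_interior.mem_nhds hξ₀)
  have hsel : ∀ ξ ∈ N, ∃ x v, ((v, ξ), x) ∈ W ∧
    ReducedKKT (range Sum.inr) (P.redGrad S) (P.redConstr S) x v ξ := fun ξ hξ => hξ.1
  choose! X V hXV using hsel
  have hbound : ∀ ξ ∈ N, ∀ ξ' ∈ N,
      ‖X ξ - X ξ'‖ ≤ ℓ * ‖ξ - ξ'‖ ∧ ‖V ξ - V ξ'‖ ≤ ℓ' * ‖ξ - ξ'‖ := fun ξ hξ ξ' hξ' =>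
    hlip _ _ _ _ _ _ (hWall _ (hXV ξ hξ).1).1 (hWall _ (hXV ξ' hξ').1).1 (hXV ξ hξ).2 (hXV ξ' hξ').2
  -- With both parameters equal to ξ₀ the Lipschitz estimate becomes uniqueness, so the arbitrary
  -- selection passes through the given base solution.
  have hbase := hlip _ _ _ _ _ _ (hWall _ (hXV ξ₀ (mem_of_mem_nhds hN)).1).1 (mem_of_mem_nhds hW₁)
    (hXV ξ₀ (mem_of_mem_nhds hN)).2 hR₀
  simp only [sub_self, norm_zero, mul_zero, norm_le_zero_iff, sub_eq_zero] at hbase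
  have hVcont : ContinuousOn V N :=
    (LipschitzOnWith.of_dist_le_mul (K := ⟨ℓ', hℓ'⟩) fun ξ hξ ξ' hξ' => by
      rw [dist_eq_norm, dist_eq_norm]; exact (hbound ξ hξ ξ' hξ').2).continuousOn
  refine ⟨N, X, fun ξ => eqPart (V ξ), fun ξ => ineqPart (V ξ), hN,
    fun ξ hξ => interior_subset hξ.2, ?_, ?_, ?_, hbase.1, ?_, ?_, ?_, ?_⟩
  · exact (LipschitzOnWith.of_dist_le_mul (K := ⟨ℓ, hℓ⟩) fun ξ hξ ξ' hξ' => by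
      rw [dist_eq_norm, dist_eq_norm]; exact (hbound ξ hξ ξ' hξ').1).continuousOn
  · exact continuous_eqPart.comp_continuousOn hVcont
  · exact continuous_ineqPart.comp_continuousOn hVcont
  · simp only [hbase.2, hl₀]
  · simp only [hbase.2, hu₀]
  · intro ξ hξ
    obtain ⟨hmem, hK⟩ := hXV ξ hξ
    obtain ⟨-, hco, hin, hij⟩ := hWall _ hmem
    -- The Hessian is coercive in all directions near the base point, so the critical subspace in
    -- SSOSC plays no role.
    refine ⟨hC2.licq_of_injective hξ.2 hin hij, hK.kkt hin, fun y hy _ _ => ?_⟩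
    have hy' : 0 < ‖y‖ := norm_pos_iff.2 hy
    exact lt_of_lt_of_le (by positivity) (hco y)
  · intro ξ hξ
    obtain ⟨hmem, hK⟩ := hXV ξ hξ
    obtain ⟨-, hco, hin, -⟩ := hWall _ hmem
    exact (hK.kkt hin).isLocalMinOn (isLocalMin_of_gradient_eq_zero
      (hC2.contDiffAt_lagrangian hξ.2 _) hK.stationary (half_pos ha) hco)

/-- Lipschitz estimates for continuous solution maps in terms of bounds for `A` and `B`. -/
theorem lipschitz_of_isSolutionMap (hC2 : P.IsC2On Ξ) (hξ₀ : ξ₀ ∈ interior Ξ)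
    (hkkt : P.KKT x₀ l₀ u₀ ξ₀) (ha : 0 < a) (hb : 0 < b)
    (hmin : ∀ y, a * ‖y‖ ^ 2 ≤ inner ℝ y (P.hessL x₀ l₀ u₀ ξ₀ y))
    (hmax : ∀ y, ‖P.hessL x₀ l₀ u₀ ξ₀ y‖ ^ 2 ≤ b * inner ℝ y (P.hessL x₀ l₀ u₀ ξ₀ y))
    (hσ : 0 < σ) (hB : ∀ v, σ * ‖v‖ ≤ ‖ContinuousLinearMap.adjoint (P.jacX x₀ ξ₀) v‖)
    {ℓ ℓ' : ℝ}
    (hℓ : ‖P.mixedL x₀ l₀ u₀ ξ₀‖ / a + √(b / a) * (‖P.jacXi x₀ ξ₀‖ / σ) < ℓ)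
    (hdual : b / a * ‖P.mixedL x₀ l₀ u₀ ξ₀‖ / σ + b * ‖P.jacXi x₀ ξ₀‖ / σ ^ 2 < ℓ')
    {N : Set (EuclideanSpace ℝ (Fin r))}
    {xs : EuclideanSpace ℝ (Fin r) → EuclideanSpace ℝ (Fin n)}
    {ls : EuclideanSpace ℝ (Fin r) → EuclideanSpace ℝ (Fin p)}
    {us : EuclideanSpace ℝ (Fin r) → EuclideanSpace ℝ (Fin m)}
    (hs : P.IsSolutionMap Ξ x₀ l₀ u₀ ξ₀ N xs ls us) :
    ∃ U ∈ 𝓝[N] ξ₀, U ⊆ N ∧ ∀ y ∈ U, ∀ z ∈ U, ‖xs y - xs z‖ ≤ ℓ * ‖y - z‖ ∧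
      ‖WithLp.toLp 2 (ls y, us y) - WithLp.toLp 2 (ls z, us z)‖ =
        ‖pack (P.active x₀ ξ₀) (ls y) (us y) - pack (P.active x₀ ξ₀) (ls z) (us z)‖ ∧
      ‖pack (P.active x₀ ξ₀) (ls y) (us y) - pack (P.active x₀ ξ₀) (ls z) (us z)‖
        ≤ ℓ' * ‖y - z‖ := by
  obtain ⟨W, hW, hlip⟩ := hC2.exists_lipschitz_nhds hξ₀ hkkt ha hb hmin hmax hσ hB hℓ hdual
  have hx : ContinuousAt xs ξ₀ := hs.continuousOn_x.continuousAt hs.mem_nhds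
  have hl : ContinuousAt ls ξ₀ := hs.continuousOn_l.continuousAt hs.mem_nhds
  have hu : ContinuousAt us ξ₀ := hs.continuousOn_u.continuousAt hs.mem_nhds
  have hv : ContinuousAt (fun ξ => pack (P.active x₀ ξ₀) (ls ξ) (us ξ)) ξ₀ :=
    ContinuousAt.comp (f := fun ξ => (ls ξ, us ξ)) continuous_pack.continuousAt (hl.prodMk hu)
  have hz : ContinuousAt (fun ξ => ((pack (P.active x₀ ξ₀) (ls ξ) (us ξ), ξ), xs ξ)) ξ₀ :=
    (hv.prodMk continuousAt_id).prodMk hx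
  have hxξ : Tendsto (fun ξ => (xs ξ, ξ)) (𝓝 ξ₀) (𝓝 (x₀, ξ₀)) := by
    rw [← hs.base_x]
    exact hx.prodMk continuousAt_id
  have hinact := hC2.eventually_inactive hξ₀ hkkt.lt_zero_of_notMem_active
  have hW' : ∀ᶠ ξ in 𝓝 ξ₀, ((pack (P.active x₀ ξ₀) (ls ξ) (us ξ), ξ), xs ξ) ∈ W := by
    refine hz ?_
    beta_reduce
    rw [hs.base_l, hs.base_u, hs.base_x]
    exact hW
  refine ⟨{ξ | ξ ∈ N ∧ ((pack (P.active x₀ ξ₀) (ls ξ) (us ξ), ξ), xs ξ) ∈ W ∧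
    ∀ i ∉ P.active x₀ ξ₀, P.g (xs ξ) ξ i < 0}, mem_nhdsWithin_of_mem_nhds ?_, fun ξ hξ => hξ.1, ?_⟩
  · filter_upwards [hs.mem_nhds, hW', hxξ.eventually hinact] with ξ h1 h2 h3 using ⟨h1, h2, h3⟩
  · rintro y ⟨hyN, hyW, hy⟩ z ⟨hzN, hzW, hz⟩
    have ky := (hs.regular y hyN).kkt
    have kz := (hs.regular z hzN).kkt
    obtain ⟨h1, h2⟩ := hlip _ _ _ _ _ _ hyW hzW (ky.reducedKKT hy) (kz.reducedKKT hz)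
    exact ⟨h1, norm_sub_eq_norm_pack_sub (ky.apply_eq_zero hy) (kz.apply_eq_zero hz), h2⟩

end IsC2On

/-! ### Comparison with the stated constants and conclusion -/

lemma ellPrimal_nonneg_of_subsingleton [Subsingleton (EuclideanSpace ℝ (Fin n))] :
    0 ≤ P.ellPrimal x₀ l₀ u₀ ξ₀ := by
  have h : lamMin (P.hessL x₀ l₀ u₀ ξ₀) = 0 := by
    have : {t : ℝ | Module.End.HasEigenvalue (P.hessL x₀ l₀ u₀ ξ₀).toLinearMap t} = ∅ := by
      refine eq_empty_of_forall_notMem fun t ht => ?_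
      obtain ⟨y, hy⟩ := Module.End.HasEigenvalue.exists_hasEigenvector ht
      exact hy.2 (Subsingleton.elim _ _)
    rw [lamMin, this, Real.sInf_empty]
  simp [ellPrimal, h]

/-- The estimate from the linear system carries √(β/α) only on the constraint term; since α ≤ β this
factor is at least 1 and may be put on both terms. Without constraints G⋆ = 0, so the value of σ is
irrelevant. -/
lemma primal_bound_le_ellPrimal {α β : ℝ} (hα : lamMin (P.hessL x₀ l₀ u₀ ξ₀) = α)
    (hβ : lamMax (P.hessL x₀ l₀ u₀ ξ₀) = β) (hα0 : 0 < α) (hαβ : α ≤ β)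
    (hσ : Nonempty (Fin p ⊕ P.active x₀ ξ₀) →
      σ = sigmaMin (ContinuousLinearMap.adjoint (P.jacX x₀ ξ₀))) :
    ‖P.mixedL x₀ l₀ u₀ ξ₀‖ / α + √(β / α) * (‖P.jacXi x₀ ξ₀‖ / σ) ≤
      P.ellPrimal x₀ l₀ u₀ ξ₀ := by
  have hG : ‖P.jacXi x₀ ξ₀‖ / sigmaMin (ContinuousLinearMap.adjoint (P.jacX x₀ ξ₀)) =
      ‖P.jacXi x₀ ξ₀‖ / σ := by
    rcases isEmpty_or_nonempty (Fin p ⊕ P.active x₀ ξ₀) with h | h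
    · have : P.jacXi x₀ ξ₀ = 0 := by
        ext d k
        exact h.elim k
      simp [this]
    · rw [hσ h]
  rw [ellPrimal, ellBase, hG, hα, hβ, mul_add]
  have h1 : 1 ≤ √(β / α) := by
    rw [Real.one_le_sqrt, one_le_div hα0]; exact hαβ
  gcongr
  exact le_mul_of_one_le_left (by positivity) h1

/-- The stated constant exceeds the derived one by exactly the factor √β / √α ≥ 1. -/
lemma dual_bound_le_ellDual {α β : ℝ} (hα : lamMin (P.hessL x₀ l₀ u₀ ξ₀) = α)
    (hβ : lamMax (P.hessL x₀ l₀ u₀ ξ₀) = β) (hα0 : 0 < α) (hαβ : α ≤ β)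
    (hne : Nonempty (Fin p ⊕ P.active x₀ ξ₀)) (hσ0 : 0 < σ)
    (hσ : σ = sigmaMin (ContinuousLinearMap.adjoint (P.jacX x₀ ξ₀))) :
    β / α * ‖P.mixedL x₀ l₀ u₀ ξ₀‖ / σ + β * ‖P.jacXi x₀ ξ₀‖ / σ ^ 2 ≤
      P.ellDual x₀ l₀ u₀ ξ₀ := by
  have hβ0 : 0 < β := hα0.trans_le hαβ
  rw [ellDual, if_neg (not_isEmpty_iff.2 hne), ellBase, ← hσ, hα, hβ]
  have h1 : 1 ≤ √β / √α := by
    rw [one_le_div (Real.sqrt_pos.2 hα0)]; exact Real.sqrt_le_sqrt hαβ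
  have h2 : β ^ (3 / 2 : ℝ) = β * √β := by
    rw [Real.sqrt_eq_rpow, show (3 / 2 : ℝ) = 1 + 1 / 2 by norm_num, Real.rpow_add hβ0,
      Real.rpow_one]
  rw [h2, ← Real.sqrt_eq_rpow]
  calc _ = 1 * (β / σ * (‖P.mixedL x₀ l₀ u₀ ξ₀‖ / α + ‖P.jacXi x₀ ξ₀‖ / σ)) := by
        field_simp
    _ ≤ √β / √α * (β / σ * (‖P.mixedL x₀ l₀ u₀ ξ₀‖ / α + ‖P.jacXi x₀ ξ₀‖ / σ)) := by gcongr
    _ = _ := by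
        have : 0 < √α := Real.sqrt_pos.2 hα0
        field_simp

end ParamNLP

theorem mainTheorem1 {n p m r : ℕ} (P : ParamNLP n p m r)
    (Ξ : Set (EuclideanSpace ℝ (Fin r))) (hC2 : P.IsC2On Ξ)
    (x₀ : EuclideanSpace ℝ (Fin n)) (l₀ : EuclideanSpace ℝ (Fin p))
    (u₀ : EuclideanSpace ℝ (Fin m)) (ξ₀ : EuclideanSpace ℝ (Fin r))
    (hξ₀ : ξ₀ ∈ interior Ξ)
    (hreg : P.IsRegularMinimizer x₀ l₀ u₀ ξ₀)
    (hA : ∀ y : EuclideanSpace ℝ (Fin n), y ≠ 0 → 0 < inner ℝ y (P.hessL x₀ l₀ u₀ ξ₀ y)) :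
    (∃ (N : Set (EuclideanSpace ℝ (Fin r)))
      (xs : EuclideanSpace ℝ (Fin r) → EuclideanSpace ℝ (Fin n))
      (ls : EuclideanSpace ℝ (Fin r) → EuclideanSpace ℝ (Fin p))
      (us : EuclideanSpace ℝ (Fin r) → EuclideanSpace ℝ (Fin m)),
      P.IsSolutionMap Ξ x₀ l₀ u₀ ξ₀ N xs ls us) ∧
    ∀ (N : Set (EuclideanSpace ℝ (Fin r)))
      (xs : EuclideanSpace ℝ (Fin r) → EuclideanSpace ℝ (Fin n))
      (ls : EuclideanSpace ℝ (Fin r) → EuclideanSpace ℝ (Fin p))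
      (us : EuclideanSpace ℝ (Fin r) → EuclideanSpace ℝ (Fin m)),
      P.IsSolutionMap Ξ x₀ l₀ u₀ ξ₀ N xs ls us →
        LocallyLipschitzAtWith (P.ellPrimal x₀ l₀ u₀ ξ₀) xs N ξ₀ ∧
        LocallyLipschitzAtWith (P.ellDual x₀ l₀ u₀ ξ₀)
          (fun ξ => WithLp.toLp 2 (ls ξ, us ξ)) N ξ₀ := by
  refine ⟨hC2.exists_isSolutionMap hξ₀ hreg hA, fun N xs ls us hs => ?_⟩
  have hinj := hC2.adjoint_jacX_injective hξ₀ hreg.licq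
  obtain ⟨σ, hσ, hB, hσ'⟩ := exists_bddBelow_of_injective hinj
  have hsym : (P.hessL x₀ l₀ u₀ ξ₀).toLinearMap.IsSymmetric :=
    hC2.hessL_symm_of_kkt hξ₀ hreg.kkt
  constructor
  · intro ℓ hℓ
    -- For n = 0 there are no eigenvalues, so `lamMin` is the infimum of the empty set and not
    -- positive; the primal claim is then trivial.
    rcases subsingleton_or_nontrivial (EuclideanSpace ℝ (Fin n)) with hn | hn
    · refine ⟨N, self_mem_nhdsWithin, Subset.rfl, fun y _ z _ => ?_⟩
      rw [Subsingleton.elim (xs y - xs z) 0, norm_zero]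
      exact mul_nonneg (P.ellPrimal_nonneg_of_subsingleton.trans hℓ.le) (norm_nonneg _)
    · have hpos := lamMin_pos hsym hA
      have hle := lamMin_le_lamMax hsym
      obtain ⟨U, hU, hUN, h⟩ := hC2.lipschitz_of_isSolutionMap hξ₀ hreg.kkt hpos
        (hpos.trans_le hle) (lamMin_mul_norm_sq_le hsym) (norm_apply_sq_le_lamMax_mul hsym hA) hσ hB
        ((ParamNLP.primal_bound_le_ellPrimal rfl rfl hpos hle hσ').trans_lt hℓ) (lt_add_one _) hs
      exact ⟨U, hU, hUN, fun y hy z hz => (h y hy z hz).1⟩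
  · intro ℓ hℓ
    rcases isEmpty_or_nonempty (Fin p ⊕ P.active x₀ ξ₀) with he | hne
    · obtain ⟨a, ha, b, hb, hmin, hmax⟩ := exists_bounds_of_pos _ hA
      obtain ⟨U, hU, hUN, h⟩ := hC2.lipschitz_of_isSolutionMap hξ₀ hreg.kkt ha hb hmin hmax hσ hB
        (lt_add_one _) (lt_add_one _) hs
      -- Without equality or active inequality constraints the stacked multipliers live in a zero
      -- space, so the dual solution is constant on U and the bound 0 suffices.
      refine ⟨U, hU, hUN, fun y hy z hz => ?_⟩
      rw [ParamNLP.ellDual, if_pos he] at hℓ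
      rw [(h y hy z hz).2.1, Subsingleton.elim (ParamNLP.pack _ (ls y) (us y))
        (ParamNLP.pack _ (ls z) (us z)), sub_self, norm_zero]
      exact mul_nonneg hℓ.le (norm_nonneg _)
    -- An injective Bᵀ from a nonzero multiplier space excludes n = 0, so the eigenvalue bounds are
    -- available.
    · have hn : Nontrivial (EuclideanSpace ℝ (Fin n)) := hinj.nontrivial
      have hpos := lamMin_pos hsym hA
      have hle := lamMin_le_lamMax hsym
      obtain ⟨U, hU, hUN, h⟩ := hC2.lipschitz_of_isSolutionMap hξ₀ hreg.kkt hpos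
        (hpos.trans_le hle) (lamMin_mul_norm_sq_le hsym) (norm_apply_sq_le_lamMax_mul hsym hA) hσ hB
        (lt_add_one _) ((ParamNLP.dual_bound_le_ellDual rfl rfl hpos hle hne hσ
          (hσ' hne)).trans_lt hℓ) hs
      refine ⟨U, hU, hUN, fun y hy z hz => ?_⟩
      rw [(h y hy z hz).2.1]
      exact (h y hy z hz).2.2
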